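/- Let $\nu>0$ and $T>0$, let $H=L^2(\mathbb R)$ and $V=H^1(\mathbb R)$ with $\|v\|_V^2=\|v\|_H^2+\|\partial_x v\|_H^2$, and let $V^*$ be the dual of $V$, where $V\hookrightarrow H=H^*\hookrightarrow V^*$. Let $$W(V)=\{y\in L^2(0,T;V) : \partial_t y\in L^2(0,T;V^*)\},\qquad \|y\|_{W(V)}^2=\|y\|_{L^2(0,T;V)}^2+\|\partial_t y\|_{L^2(0,T;V^*)}^2 ,$$ and for $y\in W(V)$ let $y(T)\in H$ be the value at $T$ of the representative of $y$ in $C([0,T];H)$. Fix $y_d\in H$. For $y\in W(V)$ let $p=p(y)\in W(V)$ denote the solution of the adjoint equation $$\langle \partial_t p(t),\phi\rangle_{V^*,V}+\langle y(t)\,\partial_x p(t),\phi\rangle_H-\nu\,\langle\partial_x p(t),\partial_x\phi\rangle_H=0\quad\text{for all }\phi\in V\text{ and a.e. }t\in(0,T),$$ $$\langle p(T),\psi\rangle_H=\langle y_d-y(T),\psi\rangle_H\quad\text{for all }\psi\in H .$$ Then the adjoint solution map $y\mapsto p(y)$ is Lipschitz on bounded sets: for every $M$ there is a constant $C$, depending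 only on $\nu$, $T$, $y_d$ and $M$, such that $$\|p(y_1)-p(y_2)\|_{L^2(0,T;V)}\le C\,\|y_1-y_2\|_{W(V)}$$ for all $y_1,y_2\in W(V)$ (and all solutions $p(y_1),p(y_2)\in W(V)$ of the corresponding adjoint equations) such that each $y_i$ satisfies $\|y_i\|_{L^\infty(0,T;V)}\le M$ or $\|y_i\|_{W(V)}\le M$. -/

import Mathlib

open MeasureTheory Set Filter Topology
open scoped ContDiff ENNReal

noncomputable section

namespace BurgersAdjoint

/-- The space `H = L²(ℝ)`. -/
abbrev H : Type := Lp ℝ 2 (volume : Measure ℝ)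

/-- `g` is the weak derivative of `u` on `ℝ`, for `u, g ∈ L²(ℝ)`. -/
def HasWeakDeriv (u g : H) : Prop :=
  ∀ η : ℝ → ℝ, ContDiff ℝ ∞ η → HasCompactSupport η →
    ∫ x, u x * deriv η x = - ∫ x, g x * η x

theorem integrable_mul_test (u : H) {η : ℝ → ℝ} (hc : Continuous η)
    (hs : HasCompactSupport η) : Integrable (fun x => u x * η x) :=
  MemLp.integrable_mul (p := 2) (q := 2) (Lp.memLp u) (hc.memLp_of_hasCompactSupport hs)

theorem HasWeakDeriv.zero : HasWeakDeriv 0 0 := by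
  intro η _ _
  have h : ((0 : H) : ℝ → ℝ) =ᵐ[volume] 0 := Lp.coeFn_zero ℝ 2 volume
  rw [integral_eq_zero_of_ae (h.mono fun x hx => by simp only [hx, Pi.zero_apply, zero_mul]),
    integral_eq_zero_of_ae (h.mono fun x hx => by simp only [hx, Pi.zero_apply, zero_mul]), neg_zero]

theorem HasWeakDeriv.add {u v g k : H} (hu : HasWeakDeriv u g) (hv : HasWeakDeriv v k) :
    HasWeakDeriv (u + v) (g + k) := by
  intro η hη hs
  have hη' : Continuous (deriv η) := hη.continuous_deriv (by simp)
  have e1 : ∫ x, (u + v : H) x * deriv η x = ∫ x, (u x * deriv η x + v x * deriv η x) :=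
    integral_congr_ae ((Lp.coeFn_add u v).mono fun x hx => by simp only [hx, Pi.add_apply, add_mul])
  have e2 : ∫ x, (g + k : H) x * η x = ∫ x, (g x * η x + k x * η x) :=
    integral_congr_ae ((Lp.coeFn_add g k).mono fun x hx => by simp only [hx, Pi.add_apply, add_mul])
  rw [e1, e2, integral_add (integrable_mul_test u hη' hs.deriv)
    (integrable_mul_test v hη' hs.deriv), integral_add (integrable_mul_test g hη.continuous hs)
    (integrable_mul_test k hη.continuous hs), hu η hη hs, hv η hη hs]
  ring

theorem HasWeakDeriv.smul {u g : H} (c : ℝ) (hu : HasWeakDeriv u g) :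
    HasWeakDeriv (c • u) (c • g) := by
  intro η hη hs
  have e1 : ∫ x, (c • u : H) x * deriv η x = ∫ x, c * (u x * deriv η x) :=
    integral_congr_ae ((Lp.coeFn_smul c u).mono fun x hx => by
      simp only [hx, Pi.smul_apply, smul_eq_mul, mul_assoc])
  have e2 : ∫ x, (c • g : H) x * η x = ∫ x, c * (g x * η x) :=
    integral_congr_ae ((Lp.coeFn_smul c g).mono fun x hx => by
      simp only [hx, Pi.smul_apply, smul_eq_mul, mul_assoc])
  rw [e1, e2, integral_const_mul, integral_const_mul, hu η hη hs]
  ring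

/-- The graph `{(u, u') : u ∈ H¹(ℝ)}` inside the Hilbert space `L²(ℝ) × L²(ℝ)`. -/
def sobolevGraph : Submodule ℝ (WithLp 2 (H × H)) where
  carrier := {v | HasWeakDeriv v.fst v.snd}
  zero_mem' := HasWeakDeriv.zero
  add_mem' := fun ha hb => HasWeakDeriv.add ha hb
  smul_mem' := fun c _ ha => HasWeakDeriv.smul c ha

/-- The space `V = H¹(ℝ)`; the weak derivative is carried along with the function, and the norm
is `‖v‖_V² = ‖v‖_H² + ‖∂ₓ v‖_H²`. -/
def V : Type := sobolevGraph

instance : NormedAddCommGroup V := Submodule.normedAddCommGroup sobolevGraph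

instance : InnerProductSpace ℝ V := Submodule.innerProductSpace sobolevGraph

/-- The embedding `V ↪ H`. -/
def V.val : V →L[ℝ] H := (WithLp.fstL 2 ℝ H H).comp sobolevGraph.subtypeL

/-- The spatial weak derivative `∂ₓ : V → H`. -/
def V.dx : V →L[ℝ] H := (WithLp.sndL 2 ℝ H H).comp sobolevGraph.subtypeL

/-- The dual space `V*` with the operator norm. -/
abbrev VDual : Type := StrongDual ℝ V

/-- Lebesgue measure on the time interval `(0, T)`. -/
abbrev timeMeasure (T : ℝ) : Measure ℝ := volume.restrict (Ioo 0 T)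

/-- The Bochner space `L²(0, T; V)`. -/
abbrev L2V (T : ℝ) : Type := Lp V 2 (timeMeasure T)

/-- The Bochner space `L²(0, T; V*)`. -/
abbrev L2VDual (T : ℝ) : Type := Lp VDual 2 (timeMeasure T)

/-- `g = ∂ₜ y` in the sense of `V*`-valued distributions on `(0, T)`, where `V ⊂ V*` through the
inner product of `H`. -/
def HasTimeDeriv (T : ℝ) (y : L2V T) (g : L2VDual T) : Prop :=
  ∀ η : ℝ → ℝ, ContDiff ℝ ∞ η → HasCompactSupport η → tsupport η ⊆ Ioo 0 T → ∀ φ : V,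
    ∫ t in Ioo 0 T, deriv η t * inner ℝ (V.val (y t)) (V.val φ)
      = - ∫ t in Ioo 0 T, η t * g t φ

theorem integrable_test_mul {E : Type*} [NormedAddCommGroup E] [NormedSpace ℝ E] {T : ℝ}
    (f : Lp E 2 (timeMeasure T)) (L : E →L[ℝ] ℝ) {η : ℝ → ℝ} (hc : Continuous η)
    (hs : HasCompactSupport η) :
    Integrable (fun t => η t * L (f t)) (timeMeasure T) :=
  MemLp.integrable_mul (p := 2) (q := 2) (hc.memLp_of_hasCompactSupport hs)
    (L.comp_memLp' (Lp.memLp f))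

/-- `v ↦ ⟨v, φ⟩_H` as a functional on `V`. -/
def pairH (φ : V) : V →L[ℝ] ℝ := (innerSL ℝ (V.val φ)).comp V.val

theorem pairH_apply (φ v : V) : pairH φ v = inner ℝ (V.val v) (V.val φ) := by
  simp only [pairH, ContinuousLinearMap.comp_apply, innerSL_apply_apply]
  exact real_inner_comm _ _

/-- `f ↦ ⟨f, φ⟩_{V*, V}` as a functional on `V*`. -/
def evalAt (φ : V) : VDual →L[ℝ] ℝ := ContinuousLinearMap.apply ℝ ℝ φ

theorem hasTimeDeriv_iff {T : ℝ} {y : L2V T} {g : L2VDual T} :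
    HasTimeDeriv T y g ↔ ∀ η : ℝ → ℝ, ContDiff ℝ ∞ η → HasCompactSupport η →
      tsupport η ⊆ Ioo 0 T → ∀ φ : V,
      ∫ t in Ioo 0 T, deriv η t * pairH φ (y t) = - ∫ t in Ioo 0 T, η t * evalAt φ (g t) := by
  simp only [HasTimeDeriv, pairH_apply]
  rfl

theorem HasTimeDeriv.zero (T : ℝ) : HasTimeDeriv T 0 0 := by
  rw [hasTimeDeriv_iff]
  intro η _ _ _ φ
  have h1 : ((0 : L2V T) : ℝ → V) =ᵐ[timeMeasure T] 0 := Lp.coeFn_zero V 2 _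
  have h2 : ((0 : L2VDual T) : ℝ → VDual) =ᵐ[timeMeasure T] 0 := Lp.coeFn_zero VDual 2 _
  rw [integral_eq_zero_of_ae (h1.mono fun x hx => by simp only [hx, Pi.zero_apply, map_zero, mul_zero]),
    integral_eq_zero_of_ae (h2.mono fun x hx => by simp only [hx, Pi.zero_apply, map_zero, mul_zero]), neg_zero]

theorem HasTimeDeriv.add {T : ℝ} {y z : L2V T} {g k : L2VDual T} (hy : HasTimeDeriv T y g)
    (hz : HasTimeDeriv T z k) : HasTimeDeriv T (y + z) (g + k) := by
  rw [hasTimeDeriv_iff] at *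
  intro η hη hs ht φ
  have hη' : Continuous (deriv η) := hη.continuous_deriv (by simp)
  have e1 : ∫ t in Ioo 0 T, deriv η t * pairH φ ((y + z : L2V T) t)
      = ∫ t in Ioo 0 T, (deriv η t * pairH φ (y t) + deriv η t * pairH φ (z t)) :=
    integral_congr_ae ((Lp.coeFn_add y z).mono fun x hx => by simp only [hx, Pi.add_apply, map_add, mul_add])
  have e2 : ∫ t in Ioo 0 T, η t * evalAt φ ((g + k : L2VDual T) t)
      = ∫ t in Ioo 0 T, (η t * evalAt φ (g t) + η t * evalAt φ (k t)) :=
    integral_congr_ae ((Lp.coeFn_add g k).mono fun x hx => by simp only [hx, Pi.add_apply, map_add, mul_add])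
  rw [e1, e2, integral_add (integrable_test_mul y _ hη' hs.deriv)
    (integrable_test_mul z _ hη' hs.deriv),
    integral_add (integrable_test_mul g _ hη.continuous hs)
    (integrable_test_mul k _ hη.continuous hs), hy η hη hs ht φ, hz η hη hs ht φ]
  ring

theorem HasTimeDeriv.smul {T : ℝ} {y : L2V T} {g : L2VDual T} (c : ℝ)
    (hy : HasTimeDeriv T y g) : HasTimeDeriv T (c • y) (c • g) := by
  rw [hasTimeDeriv_iff] at *
  intro η hη hs ht φ
  have e1 : ∫ t in Ioo 0 T, deriv η t * pairH φ ((c • y : L2V T) t)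
      = ∫ t in Ioo 0 T, c * (deriv η t * pairH φ (y t)) :=
    integral_congr_ae ((Lp.coeFn_smul c y).mono fun x hx => by
      simp only [hx, Pi.smul_apply, map_smul, smul_eq_mul, mul_left_comm])
  have e2 : ∫ t in Ioo 0 T, η t * evalAt φ ((c • g : L2VDual T) t)
      = ∫ t in Ioo 0 T, c * (η t * evalAt φ (g t)) :=
    integral_congr_ae ((Lp.coeFn_smul c g).mono fun x hx => by
      simp only [hx, Pi.smul_apply, map_smul, smul_eq_mul, mul_left_comm])
  rw [e1, e2, integral_const_mul, integral_const_mul, hy η hη hs ht φ]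
  ring

/-- The graph `{(y, ∂ₜ y)}` inside `L²(0, T; V) × L²(0, T; V*)`. -/
def evolutionGraph (T : ℝ) : Submodule ℝ (WithLp 2 (L2V T × L2VDual T)) where
  carrier := {y | HasTimeDeriv T y.fst y.snd}
  zero_mem' := HasTimeDeriv.zero T
  add_mem' := fun ha hb => HasTimeDeriv.add ha hb
  smul_mem' := fun c _ ha => HasTimeDeriv.smul c ha

/-- The space `W(V) = {y ∈ L²(0, T; V) : ∂ₜ y ∈ L²(0, T; V*)}`; the time derivative is carried
along, and `‖y‖_{W(V)}² = ‖y‖²_{L²(V)} + ‖∂ₜ y‖²_{L²(V*)}`. -/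
def W (T : ℝ) : Type := evolutionGraph T

instance (T : ℝ) : NormedAddCommGroup (W T) := Submodule.normedAddCommGroup (evolutionGraph T)

instance (T : ℝ) : NormedSpace ℝ (W T) := Submodule.normedSpace (evolutionGraph T)

/-- The element of `L²(0, T; V)` underlying `y ∈ W(V)`. -/
def W.toL2V {T : ℝ} (y : W T) : L2V T := y.1.fst

/-- The time derivative `∂ₜ y ∈ L²(0, T; V*)` of `y ∈ W(V)`. -/
def W.dt {T : ℝ} (y : W T) : L2VDual T := y.1.snd

/-- `Y` is a representative of `y` in `C([0, T]; H)`. -/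
def IsContRep {T : ℝ} (y : W T) (Y : ℝ → H) : Prop :=
  ContinuousOn Y (Icc 0 T) ∧ ∀ᵐ t ∂(timeMeasure T), Y t = V.val (y.toL2V t)

open Classical in
/-- The value `y(t) ∈ H` at `t ∈ [0, T]` of (the continuous representative of) `y ∈ W(V)`. -/
def W.valueAt {T : ℝ} (y : W T) (t : ℝ) : H :=
  if h : ∃ Y : ℝ → H, IsContRep y Y then h.choose t else 0

/-- The norm of `L^∞(0, T; V)`, with value `∞` if `y` is not essentially bounded. -/
def W.normLinftyV {T : ℝ} (y : W T) : ℝ≥0∞ := eLpNorm y.toL2V ∞ (timeMeasure T)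

/-- `p ∈ W(V)` is a solution of the adjoint equation with state `y`:
`d/dt ⟨p(t), φ⟩_H + ⟨y(t) ∂ₓ p(t), φ⟩_H - ν ⟨∂ₓ p(t), ∂ₓ φ⟩_H = 0` for all `φ ∈ V` and almost
every `t ∈ (0, T)`, and `⟨p(T), ψ⟩_H = ⟨y_d - y(T), ψ⟩_H` for all `ψ ∈ H`. -/
structure IsAdjointSolution (ν T : ℝ) (y_d : H) (y p : W T) : Prop where
  equation : ∀ φ : V, ∀ᵐ t ∂(timeMeasure T),
    p.dt t φ + (∫ x, V.val (y.toL2V t) x * V.dx (p.toL2V t) x * V.val φ x)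
      - ν * inner ℝ (V.dx (p.toL2V t)) (V.dx φ) = 0
  terminal : ∀ ψ : H, inner ℝ (p.valueAt T) ψ = inner ℝ (y_d - y.valueAt T) ψ

end BurgersAdjoint

end

/-! The proof is an energy estimate for `q = p₁ - p₂`. Subtracting the two equations and testing
with `q` gives `2⟨∂ₜq, q⟩ = 2ν‖∂ₓq‖² - 2∫ y₁ ∂ₓq q - 2∫ (y₁ - y₂) ∂ₓp₂ q`. The embedding of `H¹(ℝ)`
into `L^∞(ℝ)` (`V.ae_abs_le`) and Young's inequality bound the right side below by `ν‖∂ₓq‖² - a‖q‖²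
- ‖y₁ - y₂‖_V²` with `a = (4/ν)‖y₁‖_V² + 4‖∂ₓp₂‖²` (`adjoint_difference_ae_le`). Integrating back
from `T` and applying a Gronwall inequality with integrable coefficient (`gronwall_backward`,
`energy_estimate`) controls `q` in `L²(0,T;V)` by the data.

The terminal value of `q` is `y₂(T) - y₁(T)`, which the trace inequality `norm_valueAt_sq_le` bounds
by `‖y₁ - y₂‖_{W(V)}`. The integral of `a` is bounded in terms of `M`: for `y₁` directly, and for
`∂ₓp₂` by the same energy estimate applied to `p₂` alone.

What has to be built is the calculus of `W(V)`. As a `V*`-valued function, `y` is a primitive of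
`∂ₜy` (`ae_eq_primitive_of_weakDeriv`). The identity `d/dt ‖y‖_H² = 2⟨∂ₜy, y⟩` comes from difference
quotients and the continuity of translations in `L²` (`energy_increment`), and with it the
representative in `C([0,T];H)` (`exists_isContRep`). -/

open MeasureTheory Set Filter Topology
open scoped ContDiff ENNReal

noncomputable section

namespace BurgersAdjoint

/-! ### Weak derivatives on an interval -/

section WeakDerivative

variable {E : Type*} [NormedAddCommGroup E] [NormedSpace ℝ E]

theorem integral_Ioo_ite_le {a b t : ℝ} (ht : t ∈ Ioo a b) (g : ℝ → E) :
    ∫ s in Ioo a b, (if s ≤ t then g s else 0) = ∫ s in a..t, g s := by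
  have h1 : (fun s => if s ≤ t then g s else 0) = (Iic t).indicator g := by
    ext s; simp only [indicator, mem_Iic]
  rw [h1, setIntegral_indicator measurableSet_Iic, intervalIntegral.integral_of_le ht.1.le]
  congr 2
  ext s
  simp only [mem_inter_iff, mem_Ioo, mem_Iic, mem_Ioc]
  exact ⟨fun h => ⟨h.1.1, h.2⟩, fun h => ⟨⟨h.1, h.2.trans_lt ht.2⟩, h.2⟩⟩

theorem eq_zero_of_tsupport_subset_Ioo {a b t : ℝ} {η : ℝ → ℝ} (h : tsupport η ⊆ Ioo a b)
    (ht : t ∉ Ioo a b) : η t = 0 :=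
  image_eq_zero_of_notMem_tsupport fun h' => ht (h h')

theorem integral_Ioo_ite_deriv {a b s : ℝ} (hs : s ∈ Ioo a b) {η : ℝ → ℝ} (hη : ContDiff ℝ ∞ η)
    (hsub : tsupport η ⊆ Ioo a b) :
    ∫ t in Ioo a b, (if s ≤ t then deriv η t else 0) = - η s := by
  have h1 : (fun t => if s ≤ t then deriv η t else 0) = (Ici s).indicator (deriv η) := by
    ext t; simp only [indicator, mem_Ici]
  have h2 : Ioo a b ∩ Ici s = Ico s b := by
    ext t
    simp only [mem_inter_iff, mem_Ioo, mem_Ici, mem_Ico]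
    exact ⟨fun h => ⟨h.2, h.1.2⟩, fun h => ⟨⟨hs.1.trans_le h.1, h.2⟩, h.1⟩⟩
  rw [h1, setIntegral_indicator measurableSet_Ici, h2, integral_Ico_eq_integral_Ioc,
    ← intervalIntegral.integral_of_le hs.2.le,
    intervalIntegral.integral_deriv_eq_sub (fun x _ => (hη.differentiable (by simp)).differentiableAt)
      ((hη.continuous_deriv (by simp)).intervalIntegrable _ _),
    eq_zero_of_tsupport_subset_Ioo hsub (t := b) (by simp), zero_sub]

/-- Integration by parts for a primitive that is only absolutely continuous: Fubini on the triangle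
`s ≤ t`, where the inner integral of `deriv η` over `[s, b)` is `-η s`. -/
theorem integral_deriv_smul_primitive [CompleteSpace E] {a b : ℝ} {g : ℝ → E}
    (hg : IntegrableOn g (Ioo a b)) {η : ℝ → ℝ} (hη : ContDiff ℝ ∞ η) (hc : HasCompactSupport η)
    (hsub : tsupport η ⊆ Ioo a b) :
    ∫ t in Ioo a b, deriv η t • (∫ s in a..t, g s) = - ∫ t in Ioo a b, η t • g t := by
  have hd : Continuous (deriv η) := hη.continuous_deriv (by simp)
  have hdi : IntegrableOn (deriv η) (Ioo a b) :=
    (hd.integrable_of_hasCompactSupport hc.deriv).integrableOn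
  have hm : MeasurableSet {z : ℝ × ℝ | z.2 ≤ z.1} := measurableSet_le measurable_snd measurable_fst
  have hint : Integrable (Function.uncurry fun t s => if s ≤ t then deriv η t • g s else 0)
      ((volume.restrict (Ioo a b)).prod (volume.restrict (Ioo a b))) := by
    have := (Integrable.smul_prod hdi hg).indicator hm
    refine this.congr (Eventually.of_forall fun z => ?_)
    simp only [indicator, mem_ofPred_eq, Function.uncurry]
  calc ∫ t in Ioo a b, deriv η t • (∫ s in a..t, g s)
      = ∫ t in Ioo a b, ∫ s in Ioo a b, (if s ≤ t then deriv η t • g s else 0) := by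
        refine setIntegral_congr_fun measurableSet_Ioo fun t ht => ?_
        rw [← integral_Ioo_ite_le ht, ← integral_smul]
        congr 1; ext s; split_ifs <;> simp
    _ = ∫ s in Ioo a b, ∫ t in Ioo a b, (if s ≤ t then deriv η t • g s else 0) :=
        integral_integral_swap hint
    _ = ∫ s in Ioo a b, -(η s • g s) := by
        refine setIntegral_congr_fun measurableSet_Ioo fun s hs => ?_
        rw [← neg_smul, ← integral_Ioo_ite_deriv hs hη hsub, ← integral_smul_const]
        congr 1; ext s; split_ifs <;> simp
    _ = _ := integral_neg _

/-- A smooth function on `(a, b)` with compact support and zero mean is a derivative. -/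
theorem exists_primitive_of_integral_eq_zero {a b : ℝ} {θ : ℝ → ℝ} (hθ : ContDiff ℝ ∞ θ)
    (hc : HasCompactSupport θ) (hsub : tsupport θ ⊆ Ioo a b) (h0 : ∫ t, θ t = 0) :
    ∃ ψ : ℝ → ℝ, ContDiff ℝ ∞ ψ ∧ HasCompactSupport ψ ∧ tsupport ψ ⊆ Ioo a b ∧ deriv ψ = θ := by
  by_cases hne : (tsupport θ).Nonempty
  swap
  · rw [not_nonempty_iff_eq_empty, tsupport_eq_empty_iff] at hne
    exact ⟨0, contDiff_const, HasCompactSupport.zero, by simp [tsupport], by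
      rw [hne]; ext; simp⟩
  -- The extreme points of the support lie strictly inside `(a, b)`. The primitive vanishes to the
  -- left of `m` trivially and to the right of `M` because `θ` has mean zero, so its support stays
  -- in `[m, M]`.
  obtain ⟨m, hm, hmin⟩ := hc.isCompact.exists_isMinOn hne continuousOn_id
  obtain ⟨M, hM, hmax⟩ := hc.isCompact.exists_isMaxOn hne continuousOn_id
  have hmin' : ∀ t ∈ tsupport θ, m ≤ t := fun t ht => hmin ht
  have hmax' : ∀ t ∈ tsupport θ, t ≤ M := fun t ht => hmax ht
  have hder : ∀ t, HasDerivAt (fun t => ∫ s in a..t, θ s) (θ t) t := fun t =>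
    intervalIntegral.integral_hasDerivAt_right (hθ.continuous.intervalIntegrable _ _)
      hθ.continuous.stronglyMeasurable.stronglyMeasurableAtFilter hθ.continuous.continuousAt
  have hdeq : deriv (fun t => ∫ s in a..t, θ s) = θ := funext fun t => (hder t).deriv
  have hz : ∀ t, t ∉ Icc m M → ∫ s in a..t, θ s = 0 := by
    intro t ht
    have hz0 : ∀ s, s < m → θ s = 0 := fun s hs =>
      image_eq_zero_of_notMem_tsupport fun h => (hmin' s h).not_gt hs
    have hz1 : ∀ s, M < s → θ s = 0 := fun s hs =>
      image_eq_zero_of_notMem_tsupport fun h => (hmax' s h).not_gt hs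
    rw [mem_Icc, not_and_or, not_le, not_le] at ht
    rcases ht with ht | ht
    · refine (intervalIntegral.integral_congr (g := fun _ => (0 : ℝ)) fun s hs => ?_).trans (by simp)
      refine hz0 s ?_
      rcases le_total a t with h | h
      · rw [uIcc_of_le h] at hs; exact hs.2.trans_lt ht
      · rw [uIcc_of_ge h] at hs; exact hs.2.trans_lt (hsub hm).1
    · have haM : a < M := (hsub hM).1
      rw [intervalIntegral.integral_of_le (haM.le.trans ht.le), ← h0]
      refine setIntegral_eq_integral_of_forall_compl_eq_zero fun s hs => ?_
      rw [mem_Ioc, not_and_or, not_lt, not_le] at hs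
      rcases hs with hs | hs
      · exact hz0 s (hs.trans_lt (hsub hm).1)
      · exact hz1 s (ht.trans hs)
  have hts : tsupport (fun t => ∫ s in a..t, θ s) ⊆ Icc m M :=
    closure_minimal (fun t ht => by_contra fun h => ht (hz t h)) isClosed_Icc
  refine ⟨fun t => ∫ s in a..t, θ s, ?_, ?_, ?_, hdeq⟩
  · exact contDiff_infty_iff_deriv.2
      ⟨fun t => (hder t).differentiableAt, by rw [hdeq]; exact hθ⟩
  · exact isCompact_Icc.of_isClosed_subset (isClosed_tsupport _) hts
  · exact hts.trans fun t ht => ⟨(hsub hm).1.trans_le ht.1, ht.2.trans_lt (hsub hM).2⟩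

theorem setIntegral_Ioo_smul_eq {a b : ℝ} {η : ℝ → ℝ} (hsub : tsupport η ⊆ Ioo a b) (f : ℝ → E) :
    ∫ t in Ioo a b, η t • f t = ∫ t, η t • f t :=
  setIntegral_eq_integral_of_forall_compl_eq_zero fun t ht => by
    rw [eq_zero_of_tsupport_subset_Ioo hsub ht, zero_smul]

theorem integrable_smul_of_tsupport_subset {a b : ℝ} {f : ℝ → E} (hf : IntegrableOn f (Ioo a b))
    {η : ℝ → ℝ} (hη : Continuous η) (hc : HasCompactSupport η) :
    IntegrableOn (fun t => η t • f t) (Ioo a b) := by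
  obtain ⟨C, hC⟩ := hη.bounded_above_of_compact_support hc
  exact hf.bdd_smul C hη.aestronglyMeasurable (Eventually.of_forall hC)

/-- A function on `(a, b)` whose weak derivative vanishes is constant. -/
theorem ae_eq_const_of_weakDeriv_zero [CompleteSpace E] {a b : ℝ} (hab : a < b) {h : ℝ → E}
    (hh : IntegrableOn h (Ioo a b))
    (h0 : ∀ η : ℝ → ℝ, ContDiff ℝ ∞ η → HasCompactSupport η → tsupport η ⊆ Ioo a b →
      ∫ t in Ioo a b, deriv η t • h t = 0) :
    ∃ c : E, ∀ᵐ t ∂(volume.restrict (Ioo a b)), h t = c := by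
  obtain ⟨m, hm⟩ : (Ioo a b).Nonempty := nonempty_Ioo.2 hab
  obtain ⟨k, hk1, hk2, hk3, hk4, hkm⟩ := exists_contDiff_tsupport_subset (n := ⊤) (Ioo_mem_nhds hm.1 hm.2)
  obtain ⟨κ, hκs, hκc, hκd, hκ1⟩ : ∃ κ : ℝ → ℝ, tsupport κ ⊆ Ioo a b ∧ HasCompactSupport κ ∧
      ContDiff ℝ ∞ κ ∧ ∫ t, κ t = 1 := by
    have hpos : 0 < ∫ t, k t := by
      refine hk3.continuous.integral_pos_of_hasCompactSupport_nonneg_nonzero hk2 (x := m) ?_ ?_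
      · intro t; exact (hk4 ⟨t, rfl⟩).1
      · rw [hkm]; exact one_ne_zero
    refine ⟨fun t => (∫ t, k t)⁻¹ * k t, ?_, hk2.mul_left, contDiff_const.mul hk3, ?_⟩
    · exact (tsupport_mul_subset_right).trans hk1
    · rw [integral_const_mul, inv_mul_cancel₀ hpos.ne']
  refine ⟨∫ t in Ioo a b, κ t • h t, ?_⟩
  set c := ∫ t in Ioo a b, κ t • h t with hcdef
  have hhc : IntegrableOn (fun t => h t - c) (Ioo a b) :=
    hh.sub (integrableOn_const (by simp))
  have key := isOpen_Ioo.ae_eq_zero_of_integral_contDiff_smul_eq_zero (μ := volume)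
    hhc.locallyIntegrableOn ?_
  · rw [ae_restrict_iff' measurableSet_Ioo]
    filter_upwards [key] with t ht hmem
    exact sub_eq_zero.1 (ht hmem)
  intro η hηd hηc hηs
  set r := ∫ t, η t with hr
  have hθs : tsupport (fun t => η t - r * κ t) ⊆ Ioo a b :=
    (tsupport_sub _ _).trans (union_subset hηs (tsupport_mul_subset_right.trans hκs))
  obtain ⟨ψ, hψ1, hψ2, hψ3, hψ4⟩ := exists_primitive_of_integral_eq_zero
    (θ := fun t => η t - r * κ t) (hηd.sub (contDiff_const.mul hκd))
    (hηc.sub hκc.mul_left) hθs (by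
      rw [integral_sub (hηd.continuous.integrable_of_hasCompactSupport hηc)
        ((hκd.continuous.integrable_of_hasCompactSupport hκc).const_mul _), integral_const_mul, hκ1]
      simp [hr])
  have h1 := h0 ψ hψ1 hψ2 hψ3
  rw [hψ4] at h1
  have i1 := integrable_smul_of_tsupport_subset hh hηd.continuous hηc
  have i2 := integrable_smul_of_tsupport_subset hh hκd.continuous hκc
  have h2 : ∫ t in Ioo a b, η t • h t = r • c := by
    have : ∫ t in Ioo a b, (η t - r * κ t) • h t
        = (∫ t in Ioo a b, η t • h t) - r • c := by
      rw [hcdef, ← integral_smul, ← integral_sub i1 (i2.fun_smul r)]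
      congr 1; ext t; simp only [sub_smul, mul_smul]
    rw [this] at h1
    exact sub_eq_zero.1 h1
  rw [← setIntegral_Ioo_smul_eq hηs]
  have h3 : ∫ t in Ioo a b, η t • c = r • c := by
    rw [integral_smul_const, hr]
    congr 1
    have := setIntegral_Ioo_smul_eq hηs (fun _ => (1 : ℝ))
    simpa using this
  simp only [smul_sub]
  rw [integral_sub i1, h2, h3, sub_self]
  exact integrable_smul_of_tsupport_subset (integrableOn_const (by simp)) hηd.continuous hηc

/-- A function on `(a, b)` with an integrable weak derivative is a primitive of it. -/
theorem ae_eq_primitive_of_weakDeriv [CompleteSpace E] {a b : ℝ} (hab : a < b) {f g : ℝ → E}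
    (hf : IntegrableOn f (Ioo a b)) (hg : IntegrableOn g (Ioo a b))
    (h : ∀ η : ℝ → ℝ, ContDiff ℝ ∞ η → HasCompactSupport η → tsupport η ⊆ Ioo a b →
      ∫ t in Ioo a b, deriv η t • f t = - ∫ t in Ioo a b, η t • g t) :
    ∃ c : E, ∀ᵐ t ∂(volume.restrict (Ioo a b)), f t = c + ∫ s in a..t, g s := by
  have hG : IntegrableOn (fun t => ∫ s in a..t, g s) (Ioo a b) := by
    have : ContinuousOn (fun t => ∫ s in a..t, g s) (Icc a b) := by
      have := intervalIntegral.continuousOn_primitive_interval (f := g) (μ := volume) (a := a) (b := b)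
        (by rw [uIcc_of_le hab.le]; exact (integrableOn_Icc_iff_integrableOn_Ioo).2 hg)
      rwa [uIcc_of_le hab.le] at this
    exact this.integrableOn_Icc.mono_set Ioo_subset_Icc_self
  obtain ⟨c, hc⟩ := ae_eq_const_of_weakDeriv_zero hab (hf.sub hG) (by
    intro η hη hηc hηs
    have hd : Continuous (deriv η) := hη.continuous_deriv (by simp)
    simp only [Pi.sub_apply, smul_sub]
    rw [integral_sub (integrable_smul_of_tsupport_subset hf hd hηc.deriv)
      (integrable_smul_of_tsupport_subset hG hd hηc.deriv), h η hη hηc hηs,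
      integral_deriv_smul_primitive hg hη hηc hηs, sub_self])
  refine ⟨c, hc.mono fun t ht => ?_⟩
  simp only [Pi.sub_apply] at ht
  rw [← ht]; abel

end WeakDerivative

/-! ### Square-integrable functions and Cauchy–Schwarz -/

section SquareIntegrable

variable {α E F : Type*} [MeasurableSpace α] {μ : Measure α} [NormedAddCommGroup E]
  [NormedAddCommGroup F]

theorem MemLp.integrable_norm_sq {f : α → E} (hf : MemLp f 2 μ) :
    Integrable (fun t => ‖f t‖ ^ 2) μ :=
  (memLp_two_iff_integrable_sq_norm hf.aestronglyMeasurable).1 hf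

theorem Lp_norm_sq_eq_integral (f : Lp E 2 μ) : ‖f‖ ^ 2 = ∫ t, ‖f t‖ ^ 2 ∂μ := by
  have h0 : 0 ≤ ∫ t, ‖f t‖ ^ 2 ∂μ := integral_nonneg fun t => by positivity
  rw [Lp.norm_def, (Lp.memLp f).eLpNorm_eq_integral_rpow_norm (by simp) (by simp)]
  simp only [ENNReal.toReal_ofNat, Real.rpow_ofNat]
  rw [ENNReal.toReal_ofReal (by positivity), ← Real.rpow_natCast, ← Real.rpow_mul h0]
  norm_num

theorem integral_norm_mul_norm_le {f : α → E} {g : α → F} (hf : MemLp f 2 μ) (hg : MemLp g 2 μ) :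
    ∫ t, ‖f t‖ * ‖g t‖ ∂μ ≤ √(∫ t, ‖f t‖ ^ 2 ∂μ) * √(∫ t, ‖g t‖ ^ 2 ∂μ) := by
  have := integral_mul_le_Lp_mul_Lq_of_nonneg (p := 2) (q := 2) (μ := μ)
    (f := fun t => ‖f t‖) (g := fun t => ‖g t‖) ⟨by norm_num, by norm_num, by norm_num⟩
    (Eventually.of_forall fun t => norm_nonneg _) (Eventually.of_forall fun t => norm_nonneg _)
    (by simpa using hf.norm) (by simpa using hg.norm)
  simpa [Real.sqrt_eq_rpow] using this

theorem integrable_norm_mul_norm {f : α → E} {g : α → F} (hf : MemLp f 2 μ) (hg : MemLp g 2 μ) :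
    Integrable (fun t => ‖f t‖ * ‖g t‖) μ :=
  MemLp.integrable_mul (p := 2) (q := 2) hf.norm hg.norm

theorem integral_norm_mul_norm_le_Lp (f : Lp E 2 μ) (g : Lp F 2 μ) :
    ∫ t, ‖f t‖ * ‖g t‖ ∂μ ≤ ‖f‖ * ‖g‖ := by
  have := integral_norm_mul_norm_le (Lp.memLp f) (Lp.memLp g)
  rwa [← Lp_norm_sq_eq_integral, ← Lp_norm_sq_eq_integral, Real.sqrt_sq (norm_nonneg _),
    Real.sqrt_sq (norm_nonneg _)] at this

end SquareIntegrable

/-! ### The space `H¹(ℝ)` and its sup bound -/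

theorem V.norm_sq_eq (u : V) : ‖u‖ ^ 2 = ‖V.val u‖ ^ 2 + ‖V.dx u‖ ^ 2 :=
  WithLp.prod_norm_sq_eq_of_L2 u.1

theorem V.norm_val_le (u : V) : ‖V.val u‖ ≤ ‖u‖ :=
  le_of_sq_le_sq (by rw [u.norm_sq_eq]; nlinarith [sq_nonneg ‖V.dx u‖]) (norm_nonneg _)

theorem V.norm_dx_le (u : V) : ‖V.dx u‖ ≤ ‖u‖ :=
  le_of_sq_le_sq (by rw [u.norm_sq_eq]; nlinarith [sq_nonneg ‖V.val u‖]) (norm_nonneg _)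

instance : SecondCountableTopology V := by
  have : Fact ((2 : ℝ≥0∞) ≠ ⊤) := ⟨by simp⟩
  have : SecondCountableTopology H := inferInstance
  have : SecondCountableTopology (WithLp 2 (H × H)) := inferInstance
  exact inferInstanceAs (SecondCountableTopology sobolevGraph)

theorem integrableOn_Ioo_Lp (f : H) (a b : ℝ) : IntegrableOn f (Ioo a b) :=
  ((Lp.memLp f).restrict (Ioo a b)).integrable (by norm_num)

theorem integral_abs_Ioo_add_one_le (f : H) (a : ℝ) : ∫ x in Ioo a (a + 1), |f x| ≤ ‖f‖ := by
  have h := integral_norm_mul_norm_le (f := f) (g := fun _ => (1 : ℝ))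
    ((Lp.memLp f).restrict (Ioo a (a + 1))) (memLp_const 1)
  have h1 : ∫ x in Ioo a (a + 1), ‖f x‖ ^ 2 ≤ ‖f‖ ^ 2 := by
    rw [Lp_norm_sq_eq_integral]
    exact setIntegral_le_integral (MemLp.integrable_norm_sq (Lp.memLp f))
      (Eventually.of_forall fun t => by positivity)
  have h2 : √(∫ x in Ioo a (a + 1), ‖f x‖ ^ 2) ≤ ‖f‖ := Real.sqrt_le_iff.2 ⟨norm_nonneg _, h1⟩
  simp only [norm_one, mul_one, one_pow, integral_const, measureReal_restrict_apply_univ,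
    Real.volume_real_Ioo, smul_eq_mul, add_sub_cancel_left, zero_le_one, sup_of_le_left,
    Real.sqrt_one, Real.norm_eq_abs] at h h2
  exact h.trans h2

/-- On an interval of length one, `u` is a primitive of `∂ₓu` and oscillates by at most `‖∂ₓu‖`, by
Cauchy–Schwarz. Averaging `|u x| ≤ |u s| + ‖∂ₓu‖` over `s` gives the bound. -/
theorem ae_abs_le_Ioo (u : V) (a : ℝ) :
    ∀ᵐ x ∂(volume.restrict (Ioo a (a + 1))), |V.val u x| ≤ ‖V.val u‖ + ‖V.dx u‖ := by
  have hw : HasWeakDeriv (V.val u) (V.dx u) := u.2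
  obtain ⟨c, hc⟩ := ae_eq_primitive_of_weakDeriv (a := a) (b := a + 1) (by linarith)
    (integrableOn_Ioo_Lp (V.val u) _ _) (integrableOn_Ioo_Lp (V.dx u) _ _) (by
      intro η hη hηc hηs
      have h1 := setIntegral_Ioo_smul_eq hηs (V.dx u)
      have h2 := setIntegral_Ioo_smul_eq ((tsupport_deriv_subset (f := η)).trans hηs) (V.val u)
      rw [h1, h2]
      simp only [smul_eq_mul, mul_comm (deriv η _), mul_comm (η _)]
      exact hw η hη hηc)
  have hd : ∀ x ∈ Ioo a (a + 1), ∀ s ∈ Ioo a (a + 1),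
      |(∫ r in a..x, V.dx u r) - ∫ r in a..s, V.dx u r| ≤ ‖V.dx u‖ := by
    intro x hx s hs
    have hi : ∀ y, IntervalIntegrable (V.dx u) volume a y := fun y =>
      (((Lp.memLp (V.dx u)).locallyIntegrable (by norm_num)).integrableOn_isCompact
        isCompact_uIcc).intervalIntegrable
    rw [intervalIntegral.integral_interval_sub_left (hi _) (hi _)]
    rw [← Real.norm_eq_abs]
    refine (intervalIntegral.norm_integral_le_integral_norm_uIoc).trans ?_
    refine (setIntegral_mono_set (integrableOn_Ioo_Lp _ a (a + 1)).norm
      (Eventually.of_forall fun t => norm_nonneg _) (LE.le.eventuallyLE ?_)).trans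
      (integral_abs_Ioo_add_one_le _ a)
    intro r hr
    rcases uIoc_eq_union (a := s) (b := x) ▸ hr with h | h
    · exact ⟨hs.1.trans h.1, h.2.trans_lt hx.2⟩
    · exact ⟨hx.1.trans h.1, h.2.trans_lt hs.2⟩
  have hmem : ∀ᵐ x ∂(volume.restrict (Ioo a (a + 1))), x ∈ Ioo a (a + 1) :=
    ae_restrict_mem measurableSet_Ioo
  filter_upwards [hc, hmem] with x hx hxm
  have hle : ∫ s in Ioo a (a + 1), |V.val u x| ≤ ∫ s in Ioo a (a + 1), (|V.val u s| + ‖V.dx u‖) := by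
    refine integral_mono_ae (integrable_const _)
      ((integrableOn_Ioo_Lp (V.val u) _ _).abs.add (integrable_const _)) ?_
    filter_upwards [hc, hmem] with s hs hsm
    have h1 := hd x hxm s hsm
    have h2 : V.val u x = V.val u s + ((∫ r in a..x, V.dx u r) - ∫ r in a..s, V.dx u r) := by
      rw [hx, hs]; ring
    calc |V.val u x| ≤ |V.val u s| + _ := by rw [h2]; exact abs_add_le _ _
      _ ≤ _ := by gcongr
  rw [integral_add (integrableOn_Ioo_Lp (V.val u) _ _).abs (integrable_const _)] at hle
  simp only [integral_const, measureReal_restrict_apply_univ,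
    Real.volume_real_Ioo, smul_eq_mul, add_sub_cancel_left, zero_le_one, sup_of_le_left,
    one_mul] at hle
  linarith [integral_abs_Ioo_add_one_le (V.val u) a]

/-- The embedding of `H¹(ℝ)` into `L^∞(ℝ)`. -/
theorem V.ae_abs_le (u : V) : ∀ᵐ x, |V.val u x| ≤ 2 * ‖u‖ := by
  have h1 : ∀ n : ℤ, ∀ᵐ x, x ∈ Ioo (n : ℝ) (n + 1) → |V.val u x| ≤ 2 * ‖u‖ := fun n => by
    rw [← ae_restrict_iff' measurableSet_Ioo]
    filter_upwards [ae_abs_le_Ioo u n] with x hx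
    linarith [u.norm_val_le, u.norm_dx_le]
  -- The open unit intervals between integers cover the line up to a null set.
  have h2 : ∀ᵐ x : ℝ, ∀ n : ℤ, x ≠ n := ae_all_iff.2 fun n => by
    simp [ae_iff]
  filter_upwards [ae_all_iff.2 h1, h2] with x hx hx'
  exact hx ⌊x⌋ ⟨lt_of_le_of_ne (Int.floor_le x) (hx' _).symm, Int.lt_floor_add_one x⟩

/-! ### The convection term -/

section Convection

variable (u u' : V) (v v' φ φ' : H)

theorem integrable_convection : Integrable (fun x => V.val u x * v x * φ x) := by
  have h : Integrable (fun x => v x * φ x) :=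
    MemLp.integrable_mul (p := 2) (q := 2) (Lp.memLp v) (Lp.memLp φ)
  have := h.bdd_mul (c := 2 * ‖u‖) (Lp.aestronglyMeasurable (V.val u)) u.ae_abs_le
  simpa only [mul_assoc] using this

theorem abs_integral_convection_le :
    |∫ x, V.val u x * v x * φ x| ≤ 2 * ‖u‖ * (‖v‖ * ‖φ‖) := by
  have h : ∫ x, |V.val u x * v x * φ x| ≤ ∫ x, 2 * ‖u‖ * (‖v x‖ * ‖φ x‖) := by
    refine integral_mono_ae (integrable_convection u v φ).abs
      ((integrable_norm_mul_norm (Lp.memLp v) (Lp.memLp φ)).const_mul _) ?_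
    filter_upwards [u.ae_abs_le] with x hx
    rw [abs_mul, abs_mul, mul_assoc, Real.norm_eq_abs, Real.norm_eq_abs]
    gcongr
  refine (abs_integral_le_integral_abs).trans (h.trans ?_)
  rw [integral_const_mul]
  gcongr
  exact integral_norm_mul_norm_le_Lp v φ

theorem integral_convection_sub_left : ∫ x, V.val (u - u') x * v x * φ x
    = (∫ x, V.val u x * v x * φ x) - ∫ x, V.val u' x * v x * φ x := by
  rw [← integral_sub (integrable_convection u v φ) (integrable_convection u' v φ)]
  refine integral_congr_ae ?_
  rw [map_sub]
  filter_upwards [Lp.coeFn_sub (V.val u) (V.val u')] with x hx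
  rw [hx, Pi.sub_apply]; ring

theorem integral_convection_sub_middle : ∫ x, V.val u x * (v - v' : H) x * φ x
    = (∫ x, V.val u x * v x * φ x) - ∫ x, V.val u x * v' x * φ x := by
  rw [← integral_sub (integrable_convection u v φ) (integrable_convection u v' φ)]
  refine integral_congr_ae ?_
  filter_upwards [Lp.coeFn_sub v v'] with x hx
  rw [hx, Pi.sub_apply]; ring

theorem integral_convection_sub_right : ∫ x, V.val u x * v x * (φ - φ' : H) x
    = (∫ x, V.val u x * v x * φ x) - ∫ x, V.val u x * v x * φ' x := by
  rw [← integral_sub (integrable_convection u v φ) (integrable_convection u v φ')]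
  refine integral_congr_ae ?_
  filter_upwards [Lp.coeFn_sub φ φ'] with x hx
  rw [hx, Pi.sub_apply]; ring

theorem continuous_integral_convection : Continuous fun φ : H => ∫ x, V.val u x * v x * φ x := by
  refine (LipschitzWith.of_dist_le_mul (K := Real.toNNReal (2 * ‖u‖ * ‖v‖)) fun φ φ' => ?_).continuous
  rw [Real.dist_eq, ← integral_convection_sub_right, dist_eq_norm, Real.coe_toNNReal _ (by positivity),
    mul_assoc]
  exact abs_integral_convection_le _ _ _

end Convection

/-- The equation holds, for almost every time, with all test functions at once. -/
theorem IsAdjointSolution.ae_forall {ν T : ℝ} {y_d : H} {y p : W T}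
    (h : IsAdjointSolution ν T y_d y p) : ∀ᵐ t ∂(timeMeasure T), ∀ φ : V,
      p.dt t φ + (∫ x, V.val (y.toL2V t) x * V.dx (p.toL2V t) x * V.val φ x)
        - ν * inner ℝ (V.dx (p.toL2V t)) (V.dx φ) = 0 := by
  have h1 := ae_all_iff.2 fun n => h.equation (TopologicalSpace.denseSeq V n)
  filter_upwards [h1] with t ht φ
  have hc : Continuous fun φ : V =>
      p.dt t φ + (∫ x, V.val (y.toL2V t) x * V.dx (p.toL2V t) x * V.val φ x)
        - ν * inner ℝ (V.dx (p.toL2V t)) (V.dx φ) := by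
    have := (continuous_integral_convection (y.toL2V t) (V.dx (p.toL2V t))).comp V.val.continuous
    have h2 : Continuous fun φ : V => inner ℝ (V.dx (p.toL2V t)) (V.dx φ) :=
      continuous_const.inner V.dx.continuous
    exact ((p.dt t).continuous.add this).sub (h2.const_mul ν)
  have := hc.ext_on (TopologicalSpace.denseRange_denseSeq V) continuous_const
    (by rintro _ ⟨n, rfl⟩; exact ht n)
  exact congrFun this φ

/-! ### Translations in `L²` of the line -/

section Translation

variable {E : Type*} [NormedAddCommGroup E]

/-- Translation of a square integrable function on the line. -/
def translate (r : ℝ) : Lp E 2 (volume : Measure ℝ) →+ Lp E 2 (volume : Measure ℝ) :=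
  Lp.compMeasurePreserving (fun t => t + r) (measurePreserving_add_right volume r)

theorem coeFn_translate (r : ℝ) (f : Lp E 2 (volume : Measure ℝ)) :
    ∀ᵐ t, translate r f t = f (t + r) :=
  Lp.coeFn_compMeasurePreserving f (measurePreserving_add_right volume r)

theorem norm_translate (r : ℝ) (f : Lp E 2 (volume : Measure ℝ)) : ‖translate r f‖ = ‖f‖ :=
  Lp.norm_compMeasurePreserving f (measurePreserving_add_right volume r)

theorem eventually_norm_translate_sub_lt (f : Lp E 2 (volume : Measure ℝ)) {ε : ℝ} (hε : 0 < ε) :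
    ∃ δ > 0, ∀ r : ℝ, |r| < δ → ‖translate r f - f‖ < ε := by
  let G : C(ℝ × ℝ, ℝ) := ⟨fun z => z.2 + z.1, by fun_prop⟩
  have hc : Continuous fun r : ℝ => translate r f :=
    Continuous.compMeasurePreservingLp (f := fun _ => f) continuous_const G.curry.continuous
      (fun r => measurePreserving_add_right volume r) (by simp)
  have h0 : translate 0 f = f := by
    refine Lp.ext ((coeFn_translate 0 f).mono fun t ht => ?_)
    rw [ht, add_zero]
  obtain ⟨δ, hδ, h⟩ := Metric.continuousAt_iff.1 (hc.continuousAt (x := 0)) ε hε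
  refine ⟨δ, hδ, fun r hr => ?_⟩
  have := h (x := r) (by simpa using hr)
  rwa [h0, dist_eq_norm] at this

end Translation

/-! ### The duality pairing integrated in time -/

section Pairing

variable {X : Type*} [NormedAddCommGroup X] [NormedSpace ℝ X] {α : Type*} [MeasurableSpace α]
  {μ : Measure α}

theorem integrable_pairing {u : α → StrongDual ℝ X} {z : α → X} (hu : MemLp u 2 μ)
    (hz : MemLp z 2 μ) : Integrable (fun t => u t (z t)) μ := by
  refine (integrable_norm_mul_norm hu hz).mono' ?_ (Eventually.of_forall fun t => (u t).le_opNorm _)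
  exact isBoundedBilinearMap_apply.continuous.comp_aestronglyMeasurable
    (hu.aestronglyMeasurable.prodMk hz.aestronglyMeasurable)

theorem norm_setIntegral_pairing_le (u : Lp (StrongDual ℝ X) 2 μ) (z : Lp X 2 μ) (s : Set α) :
    ‖∫ t in s, u t (z t) ∂μ‖ ≤ ‖u‖ * ‖z‖ := by
  refine (norm_integral_le_integral_norm _).trans (le_trans ?_ (integral_norm_mul_norm_le_Lp u z))
  have hi := integrable_pairing (Lp.memLp u) (Lp.memLp z)
  exact (setIntegral_le_integral hi.norm (Eventually.of_forall fun t => norm_nonneg _)).trans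
    (integral_mono hi.norm (integrable_norm_mul_norm (Lp.memLp u) (Lp.memLp z))
      fun t => (u t).le_opNorm _)

variable (μ) in
/-- The duality pairing of `L²(X*)` and `L²(X)`, restricted to a set. -/
def pairOn (s : Set α) (u : Lp (StrongDual ℝ X) 2 μ) (z : Lp X 2 μ) : ℝ := ∫ t in s, u t (z t) ∂μ

theorem pairOn_sub_left (s : Set α) (u u' : Lp (StrongDual ℝ X) 2 μ) (z : Lp X 2 μ) :
    pairOn μ s (u - u') z = pairOn μ s u z - pairOn μ s u' z := by
  unfold pairOn
  rw [← integral_sub (integrable_pairing (Lp.memLp u) (Lp.memLp z)).integrableOn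
    (integrable_pairing (Lp.memLp u') (Lp.memLp z)).integrableOn]
  refine integral_congr_ae (ae_restrict_of_ae ((Lp.coeFn_sub u u').mono fun t ht => ?_))
  simp only [ht, Pi.sub_apply, sub_apply]

theorem pairOn_sub_right (s : Set α) (u : Lp (StrongDual ℝ X) 2 μ) (z z' : Lp X 2 μ) :
    pairOn μ s u (z - z') = pairOn μ s u z - pairOn μ s u z' := by
  unfold pairOn
  rw [← integral_sub (integrable_pairing (Lp.memLp u) (Lp.memLp z)).integrableOn
    (integrable_pairing (Lp.memLp u) (Lp.memLp z')).integrableOn]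
  refine integral_congr_ae (ae_restrict_of_ae ((Lp.coeFn_sub z z').mono fun t ht => ?_))
  simp only [ht, Pi.sub_apply, map_sub]

theorem pairOn_add_right (s : Set α) (u : Lp (StrongDual ℝ X) 2 μ) (z z' : Lp X 2 μ) :
    pairOn μ s u (z + z') = pairOn μ s u z + pairOn μ s u z' := by
  unfold pairOn
  rw [← integral_add (integrable_pairing (Lp.memLp u) (Lp.memLp z)).integrableOn
    (integrable_pairing (Lp.memLp u) (Lp.memLp z')).integrableOn]
  refine integral_congr_ae (ae_restrict_of_ae ((Lp.coeFn_add z z').mono fun t ht => ?_))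
  simp only [ht, Pi.add_apply, map_add]

end Pairing

/-! ### Limit of the difference quotients of the energy -/

section DifferenceQuotient

variable {X : Type*} [NormedAddCommGroup X] [NormedSpace ℝ X]
  (g : Lp (StrongDual ℝ X) 2 (volume : Measure ℝ)) (y : Lp X 2 (volume : Measure ℝ))

theorem abs_pairOn_translate_sub_le (s : Set ℝ) (r h : ℝ) :
    |pairOn volume s (translate r g) (translate h y + y) - 2 * pairOn volume s g y|
      ≤ ‖translate r g - g‖ * (2 * ‖y‖) + ‖g‖ * ‖translate h y - y‖ := by
  have h1 : pairOn volume s (translate r g) (translate h y + y) - 2 * pairOn volume s g y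
      = pairOn volume s (translate r g - g) (translate h y + y)
        + pairOn volume s g (translate h y - y) := by
    rw [pairOn_sub_left, pairOn_sub_right, pairOn_add_right s g]; ring
  rw [h1]
  refine (abs_add_le _ _).trans (add_le_add ?_ (norm_setIntegral_pairing_le _ _ _))
  refine (norm_setIntegral_pairing_le _ _ _).trans ?_
  gcongr
  refine (norm_add_le _ _).trans ?_
  rw [norm_translate, two_mul]

theorem pairOn_translate_eq (s : Set ℝ) (r h : ℝ) :
    pairOn volume s (translate r g) (translate h y + y)
      = ∫ t in s, g (t + r) (y (t + h) + y t) := by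
  refine integral_congr_ae (ae_restrict_of_ae ?_)
  filter_upwards [coeFn_translate r g, coeFn_translate h y, Lp.coeFn_add (translate h y) y]
    with t h1 h2 h3
  rw [h1, h3, Pi.add_apply, h2]

theorem integrable_shifted_pairing (a b h : ℝ) :
    IntegrableOn (Function.uncurry fun t s => g (t + h * s) (y (t + h) + y t))
      (uIoc a b ×ˢ uIoc 0 1) := by
  have hm : StronglyMeasurable (Function.uncurry fun t s => g (t + h * s) (y (t + h) + y t)) := by
    refine isBoundedBilinearMap_apply.continuous.comp_stronglyMeasurable
      (StronglyMeasurable.prodMk ?_ ?_)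
    · exact (Lp.stronglyMeasurable g).comp_measurable (by fun_prop)
    · exact ((Lp.stronglyMeasurable y).comp_measurable (by fun_prop)).add
        ((Lp.stronglyMeasurable y).comp_measurable (by fun_prop))
  have hz : MemLp (fun t => y (t + h) + y t) 2 volume :=
    ((Lp.memLp y).comp_measurePreserving (measurePreserving_add_right volume h)).add (Lp.memLp y)
  have hg : ∀ s, MemLp (fun t => g (t + h * s)) 2 volume := fun s =>
    (Lp.memLp g).comp_measurePreserving (measurePreserving_add_right volume (h * s))
  rw [IntegrableOn, Measure.volume_eq_prod, ← Measure.prod_restrict,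
    integrable_prod_iff' hm.aestronglyMeasurable]
  refine ⟨Eventually.of_forall fun s => (integrable_pairing (hg s) hz).integrableOn, ?_⟩
  have hfin : IsFiniteMeasure ((volume : Measure ℝ).restrict (uIoc 0 1)) :=
    ⟨by simp [uIoc_of_le]⟩
  refine Integrable.of_bound (C := ‖g‖ * (2 * ‖y‖))
    hm.norm.integral_prod_left'.aestronglyMeasurable (Eventually.of_forall fun s => ?_)
  rw [Real.norm_of_nonneg (integral_nonneg fun t => norm_nonneg _)]
  have e1 : ∫ t, ‖g (t + h * s)‖ * ‖y (t + h) + y t‖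
      = ∫ t, ‖translate (h * s) g t‖ * ‖(translate h y + y) t‖ := by
    refine integral_congr_ae ?_
    filter_upwards [coeFn_translate (h * s) g, coeFn_translate h y,
      Lp.coeFn_add (translate h y) y] with t h1 h2 h3
    rw [h1, h3, Pi.add_apply, h2]
  calc ∫ t in uIoc a b, ‖g (t + h * s) (y (t + h) + y t)‖
      ≤ ∫ t, ‖g (t + h * s) (y (t + h) + y t)‖ :=
        setIntegral_le_integral (integrable_pairing (hg s) hz).norm
          (Eventually.of_forall fun t => norm_nonneg _)
    _ ≤ ∫ t, ‖g (t + h * s)‖ * ‖y (t + h) + y t‖ :=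
        integral_mono (integrable_pairing (hg s) hz).norm (integrable_norm_mul_norm (hg s) hz)
          fun t => (g (t + h * s)).le_opNorm _
    _ ≤ ‖translate (h * s) g‖ * ‖translate h y + y‖ := e1 ▸ integral_norm_mul_norm_le_Lp _ _
    _ ≤ ‖g‖ * (2 * ‖y‖) := by
        rw [norm_translate, two_mul]
        gcongr
        exact (norm_add_le _ _).trans (by rw [norm_translate])

theorem intervalIntegrable_Lp {E : Type*} [NormedAddCommGroup E]
    (f : Lp E 2 (volume : Measure ℝ)) (a b : ℝ) : IntervalIntegrable f volume a b :=
  (((Lp.memLp f).locallyIntegrable (by norm_num)).integrableOn_isCompact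
    isCompact_uIcc).intervalIntegrable

theorem intervalIntegral_dual_apply {f : ℝ → StrongDual ℝ X} {a b : ℝ}
    (hf : IntervalIntegrable f volume a b) (v : X) :
    (∫ r in a..b, f r) v = ∫ r in a..b, f r v :=
  ((ContinuousLinearMap.apply ℝ ℝ v).intervalIntegral_comp_comm hf).symm

/-- The substitution `r = t + h s` and Fubini turn the increment into an average over `s` of
pairings of translates, to which continuity of translation applies uniformly in `s`. -/
theorem integral_increment_pairing (a b h : ℝ) :
    ∫ t in a..b, (∫ r in t..t + h, g r) (y (t + h) + y t)
      = h * ∫ s in (0 : ℝ)..1, ∫ t in a..b, g (t + h * s) (y (t + h) + y t) := by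
  rw [← intervalIntegral_intervalIntegral_swap (integrable_shifted_pairing g y a b h),
    ← intervalIntegral.integral_const_mul]
  congr 1
  ext t
  rw [intervalIntegral_dual_apply (intervalIntegrable_Lp g _ _)]
  have := intervalIntegral.smul_integral_comp_add_mul (a := 0) (b := 1)
    (fun r => g r (y (t + h) + y t)) h t
  simp only [mul_zero, add_zero, mul_one, smul_eq_mul] at this
  exact this.symm

theorem tendsto_difference_quotient_pairing {a b : ℝ} (hab : a ≤ b) :
    Tendsto (fun h : ℝ => h⁻¹ * ∫ t in a..b, (∫ r in t..t + h, g r) (y (t + h) + y t))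
      (𝓝[>] 0) (𝓝 (2 * ∫ t in a..b, g t (y t))) := by
  rw [Metric.tendsto_nhdsWithin_nhds]
  intro ε hε
  -- The summand `1` makes `K` positive and the final inequality strict.
  set K := 2 * ‖y‖ + ‖g‖ + 1 with hK
  have hKpos : 0 < K := by positivity
  obtain ⟨δ₁, hδ₁, h₁⟩ := eventually_norm_translate_sub_lt g (div_pos hε hKpos)
  obtain ⟨δ₂, hδ₂, h₂⟩ := eventually_norm_translate_sub_lt y (div_pos hε hKpos)
  refine ⟨min δ₁ δ₂, lt_min hδ₁ hδ₂, fun {h} hpos hlt => ?_⟩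
  have hpos' : 0 < h := hpos
  rw [Real.dist_eq, sub_zero, lt_min_iff] at hlt
  rw [integral_increment_pairing, inv_mul_cancel_left₀ hpos'.ne', Real.dist_eq]
  have hswap := (integrable_shifted_pairing g y a b h)
  have hint : IntervalIntegrable (fun s => ∫ t in a..b, g (t + h * s) (y (t + h) + y t))
      volume 0 1 := by
    rw [intervalIntegrable_iff]
    simp only [intervalIntegral.integral_of_le hab]
    rw [IntegrableOn, Measure.volume_eq_prod, ← Measure.prod_restrict, uIoc_of_le hab] at hswap
    exact hswap.integral_prod_right
  have hsub : (∫ s in (0 : ℝ)..1, ∫ t in a..b, g (t + h * s) (y (t + h) + y t))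
      - 2 * ∫ t in a..b, g t (y t) = ∫ s in (0 : ℝ)..1,
        ((∫ t in a..b, g (t + h * s) (y (t + h) + y t)) - 2 * ∫ t in a..b, g t (y t)) := by
    rw [intervalIntegral.integral_sub hint intervalIntegrable_const]
    simp
  have hbound : ∀ s ∈ uIoc (0 : ℝ) 1,
      ‖(∫ t in a..b, g (t + h * s) (y (t + h) + y t)) - 2 * ∫ t in a..b, g t (y t)‖
        ≤ ε / K * (2 * ‖y‖ + ‖g‖) := by
    intro s hs
    rw [uIoc_of_le zero_le_one] at hs
    have hle := abs_pairOn_translate_sub_le g y (Ioc a b) (h * s) h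
    rw [pairOn_translate_eq] at hle
    simp only [pairOn] at hle
    rw [intervalIntegral.integral_of_le hab, intervalIntegral.integral_of_le hab, Real.norm_eq_abs]
    refine hle.trans ?_
    have hs' : |h * s| < δ₁ := by
      rw [abs_mul, abs_of_pos hs.1]
      exact (mul_le_of_le_one_right (abs_nonneg h) hs.2).trans_lt hlt.1
    have l1 := (h₁ _ hs').le
    have l2 := (h₂ _ hlt.2).le
    calc _ ≤ ε / K * (2 * ‖y‖) + ‖g‖ * (ε / K) := by gcongr
      _ = _ := by ring
  rw [hsub, ← Real.norm_eq_abs]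
  refine (intervalIntegral.norm_integral_le_of_norm_le_const hbound).trans_lt ?_
  rw [sub_zero, abs_one, mul_one, div_mul_eq_mul_div, div_lt_iff₀ hKpos]
  exact mul_lt_mul_of_pos_left (by linarith) hε

end DifferenceQuotient

/-! ### The energy identity almost everywhere -/

section Energy

variable {X : Type*} [NormedAddCommGroup X] [NormedSpace ℝ X]

theorem hasDerivAt_slope_tendsto {F : ℝ → ℝ} {F' x : ℝ} (h : HasDerivAt F F' x) :
    Tendsto (fun h => h⁻¹ * (F (x + h) - F x)) (𝓝[>] 0) (𝓝 F') := by
  simpa only [smul_eq_mul] using h.tendsto_slope_zero_right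

/-- Symmetry of `B` gives `B(y(t+h), y(t+h)) - B(y(t), y(t)) = (B y(t+h) - B y(t))(y(t+h) + y(t))`,
and the first factor is `∫ g` over `[t, t+h]`. Integrate over `[a, b]`, divide by `h` and let `h →
0⁺`: the left side telescopes to averages near `b` and `a`, which converge by `hda` and `hdb`. -/
theorem energy_increment {B : X →L[ℝ] StrongDual ℝ X} (hB : ∀ v w, B v w = B w v) {T : ℝ}
    {g : Lp (StrongDual ℝ X) 2 (volume : Measure ℝ)} {y : Lp X 2 (volume : Measure ℝ)}
    {c : StrongDual ℝ X}
    (hc : ∀ᵐ t, t ∈ Ioo 0 T → B (y t) = c + ∫ r in (0 : ℝ)..t, g r) {a b : ℝ}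
    (ha : 0 < a) (hab : a ≤ b) (hb : b < T)
    (hda : HasDerivAt (fun t => ∫ r in (0 : ℝ)..t, B (y r) (y r)) (B (y a) (y a)) a)
    (hdb : HasDerivAt (fun t => ∫ r in (0 : ℝ)..t, B (y r) (y r)) (B (y b) (y b)) b) :
    B (y b) (y b) - B (y a) (y a) = 2 * ∫ t in a..b, g t (y t) := by
  have hE : Integrable (fun t => B (y t) (y t)) :=
    integrable_pairing (B.comp_memLp' (Lp.memLp y)) (Lp.memLp y)
  refine tendsto_nhds_unique ?_ (tendsto_difference_quotient_pairing g y hab)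
  refine ((hasDerivAt_slope_tendsto hdb).sub (hasDerivAt_slope_tendsto hda)).congr' ?_
  -- For `h < T - b` the shifted times stay in `(0, T)`, where `hc` is available.
  filter_upwards [Ioo_mem_nhdsGT (sub_pos.2 hb)] with h hh
  rw [← mul_sub]
  congr 1
  have hshift : ∀ᵐ t, t + h ∈ Ioo 0 T → B (y (t + h)) = c + ∫ r in (0 : ℝ)..(t + h), g r :=
    (measurePreserving_add_right volume h).quasiMeasurePreserving.tendsto_ae.eventually hc
  have e1 : ∫ t in a..b, (∫ r in t..t + h, g r) (y (t + h) + y t)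
      = ∫ t in a..b, (B (y (t + h)) (y (t + h)) - B (y t) (y t)) := by
    refine intervalIntegral.integral_congr_ae ?_
    filter_upwards [hc, hshift] with t h1 h2 hmem
    rw [uIoc_of_le hab] at hmem
    have h3 := h1 ⟨ha.trans hmem.1, hmem.2.trans_lt hb⟩
    have h4 := h2 ⟨by linarith [hmem.1, hh.1], by linarith [hmem.2, hh.2]⟩
    have h5 : ∫ r in t..t + h, g r = B (y (t + h)) - B (y t) := by
      rw [h3, h4, add_sub_add_left_eq_sub, intervalIntegral.integral_interval_sub_left
        (intervalIntegrable_Lp g _ _) (intervalIntegrable_Lp g _ _)]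
    rw [h5, sub_apply, map_add, map_add, hB (y t) (y (t + h))]
    ring
  have e2 := intervalIntegral.integral_interval_sub_left (a := 0) (b := b + h) (c := a + h)
    hE.intervalIntegrable hE.intervalIntegrable
  have e3 := intervalIntegral.integral_interval_sub_left (a := 0) (b := b) (c := a)
    hE.intervalIntegrable hE.intervalIntegrable
  rw [e1, intervalIntegral.integral_sub (hE.comp_add_right h).intervalIntegrable
    hE.intervalIntegrable, intervalIntegral.integral_comp_add_right (fun t => B (y t) (y t)),
    ← e2, ← e3]
  ring

theorem ae_energy_eq {B : X →L[ℝ] StrongDual ℝ X} (hB : ∀ v w, B v w = B w v) {T : ℝ}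
    (hT : 0 < T) {g : Lp (StrongDual ℝ X) 2 (volume : Measure ℝ)}
    {y : Lp X 2 (volume : Measure ℝ)} {c : StrongDual ℝ X}
    (hc : ∀ᵐ t, t ∈ Ioo 0 T → B (y t) = c + ∫ r in (0 : ℝ)..t, g r) :
    ∃ K : ℝ, ∀ᵐ t, t ∈ Ioo 0 T → B (y t) (y t) = K + 2 * ∫ r in (0 : ℝ)..t, g r (y r) := by
  have hE : Integrable (fun t => B (y t) (y t)) :=
    integrable_pairing (B.comp_memLp' (Lp.memLp y)) (Lp.memLp y)
  have hP : Integrable (fun t => g t (y t)) := integrable_pairing (Lp.memLp g) (Lp.memLp y)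
  have hd : ∀ᵐ t, HasDerivAt (fun t => ∫ r in (0 : ℝ)..t, B (y r) (y r)) (B (y t) (y t)) t := by
    filter_upwards [LocallyIntegrable.ae_hasDerivAt_integral hE.locallyIntegrable] with t ht using ht 0
  have hne : (ae (volume.restrict (Ioo 0 T))).NeBot := by
    rw [ae_neBot, Ne, Measure.restrict_eq_zero]; simp [hT]
  -- One differentiability point of the primitive of the energy serves as base point and fixes the
  -- constant.
  obtain ⟨a, hda, ha⟩ := ((ae_restrict_of_ae hd).and (ae_restrict_mem measurableSet_Ioo)).exists
    (f := ae (volume.restrict (Ioo 0 T)))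
  refine ⟨B (y a) (y a) - 2 * ∫ r in (0 : ℝ)..a, g r (y r), ?_⟩
  filter_upwards [hd] with t hdt ht
  have hsplit := intervalIntegral.integral_interval_sub_left (a := 0) (b := t) (c := a)
    hP.intervalIntegrable hP.intervalIntegrable
  rcases le_total a t with hat | hta
  · have := energy_increment hB hc ha.1 hat ht.2 hda hdt
    rw [← hsplit] at this
    linarith
  · have := energy_increment hB hc ht.1 hta ha.2 hdt hda
    rw [intervalIntegral.integral_symm, ← hsplit] at this
    linarith

end Energy

/-- The embedding `V ↪ V*` through the inner product of `H`. -/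
def embDual : V →L[ℝ] VDual := (innerSL ℝ).bilinearComp V.val V.val

theorem embDual_apply (v w : V) : embDual v w = inner ℝ (V.val v) (V.val w) := rfl

theorem embDual_self (v : V) : embDual v v = ‖V.val v‖ ^ 2 :=
  (embDual_apply v v).trans (real_inner_self_eq_norm_sq _)

/-! ### Primitive and energy identity on `(0, T)` -/

section TimeDependent

variable {T : ℝ}

theorem integrable_Lp_time {E : Type*} [NormedAddCommGroup E] (f : Lp E 2 (timeMeasure T)) :
    IntegrableOn f (Ioo 0 T) := (Lp.memLp f).integrable (by norm_num)

theorem HasTimeDeriv.ae_eq_primitive (hT : 0 < T) {y : L2V T} {g : L2VDual T}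
    (h : HasTimeDeriv T y g) :
    ∃ c : VDual, ∀ᵐ t ∂(timeMeasure T), embDual (y t) = c + ∫ r in (0 : ℝ)..t, g r := by
  have hy : IntegrableOn (fun t => embDual (y t)) (Ioo 0 T) :=
    embDual.integrable_comp (integrable_Lp_time y)
  refine ae_eq_primitive_of_weakDeriv hT hy (integrable_Lp_time g) fun η hη hηc hηs => ?_
  have hd : Continuous (deriv η) := hη.continuous_deriv (by simp)
  have i1 := integrable_smul_of_tsupport_subset hy hd hηc.deriv
  have i2 := integrable_smul_of_tsupport_subset (integrable_Lp_time g) hη.continuous hηc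
  ext φ
  rw [neg_apply, ContinuousLinearMap.integral_apply i1, ContinuousLinearMap.integral_apply i2]
  exact h η hη hηc hηs φ

/-- Extension by zero from `(0, T)` to the line. -/
def extendZero {E : Type*} [NormedAddCommGroup E] (f : Lp E 2 (timeMeasure T)) :
    Lp E 2 (volume : Measure ℝ) :=
  ((memLp_indicator_iff_restrict measurableSet_Ioo).2 (Lp.memLp f)).toLp ((Ioo 0 T).indicator f)

theorem extendZero_ae {E : Type*} [NormedAddCommGroup E] (f : Lp E 2 (timeMeasure T)) :
    ∀ᵐ t, t ∈ Ioo 0 T → extendZero f t = f t := by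
  have h : extendZero f =ᵐ[volume] (Ioo 0 T).indicator f := MemLp.coeFn_toLp _
  filter_upwards [h] with t ht hmem
  rw [ht, indicator_of_mem hmem]

theorem intervalIntegral_congr_Ioo {E : Type*} [NormedAddCommGroup E] [NormedSpace ℝ E]
    {f k : ℝ → E} (h : ∀ᵐ t, t ∈ Ioo 0 T → f t = k t) {a b : ℝ} (ha : a ∈ Icc 0 T)
    (hb : b ∈ Icc 0 T) : ∫ r in a..b, f r = ∫ r in a..b, k r := by
  refine intervalIntegral.integral_congr_ae ?_
  have h0 : ∀ᵐ t : ℝ, t ≠ 0 ∧ t ≠ T := by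
    filter_upwards [compl_mem_ae_iff.2 (measure_singleton (μ := (volume : Measure ℝ)) 0),
      compl_mem_ae_iff.2 (measure_singleton (μ := (volume : Measure ℝ)) T)] with t h1 h2
    exact ⟨h1, h2⟩
  filter_upwards [h, h0] with t ht hne hmem
  have hm : t ∈ Icc 0 T := by
    have : t ∈ uIcc a b := uIoc_subset_uIcc hmem
    exact (uIcc_subset_Icc ha hb) this
  exact ht ⟨lt_of_le_of_ne hm.1 hne.1.symm, lt_of_le_of_ne hm.2 hne.2⟩

theorem HasTimeDeriv.ae_energy_eq (hT : 0 < T) {y : L2V T} {g : L2VDual T}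
    (h : HasTimeDeriv T y g) :
    ∃ K : ℝ, ∀ᵐ t ∂(timeMeasure T),
      ‖V.val (y t)‖ ^ 2 = K + 2 * ∫ r in (0 : ℝ)..t, g r (y r) := by
  obtain ⟨c, hc⟩ := h.ae_eq_primitive hT
  rw [ae_restrict_iff' measurableSet_Ioo] at hc
  have hy := extendZero_ae y
  have hg := extendZero_ae g
  obtain ⟨K, hK⟩ := BurgersAdjoint.ae_energy_eq (B := embDual) (T := T)
    (g := extendZero g) (y := extendZero y) (c := c)
    (fun v w => real_inner_comm (V.val w) (V.val v)) hT (by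
      filter_upwards [hc, hy] with t h1 h2 ht
      rw [h2 ht, h1 ht, intervalIntegral_congr_Ioo hg (left_mem_Icc.2 hT.le) (Ioo_subset_Icc_self ht)])
  refine ⟨K, (ae_restrict_iff' measurableSet_Ioo).2 ?_⟩
  filter_upwards [hK, hy] with t h1 h2 ht
  have h3 := h1 ht
  rw [h2 ht, embDual_self] at h3
  rw [h3, intervalIntegral_congr_Ioo (k := fun r => g r (y r)) _ (left_mem_Icc.2 hT.le)
    (Ioo_subset_Icc_self ht)]
  filter_upwards [hy, hg] with r h4 h5 hr
  rw [h4 hr, h5 hr]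

end TimeDependent

/-! ### The representative in `C([0, T]; H)` -/

section ContinuousRepresentative

variable {T : ℝ}

theorem intervalIntegrable_of_Ioo {E : Type*} [NormedAddCommGroup E] {f : ℝ → E}
    (hf : IntegrableOn f (Ioo 0 T)) {a b : ℝ} (ha : a ∈ Icc 0 T) (hb : b ∈ Icc 0 T) :
    IntervalIntegrable f volume a b :=
  (((integrableOn_Icc_iff_integrableOn_Ioo).2 hf).mono_set (uIcc_subset_Icc ha hb)).intervalIntegrable

theorem continuousOn_primitive_Ioo {E : Type*} [NormedAddCommGroup E] [NormedSpace ℝ E]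
    {f : ℝ → E} (hT : 0 ≤ T) (hf : IntegrableOn f (Ioo 0 T)) :
    ContinuousOn (fun t => ∫ r in (0 : ℝ)..t, f r) (Icc 0 T) := by
  have := intervalIntegral.continuousOn_primitive_interval (f := f) (μ := volume) (a := 0) (b := T)
    (by rw [uIcc_of_le hT]; exact (integrableOn_Icc_iff_integrableOn_Ioo).2 hf)
  rwa [uIcc_of_le hT] at this

/-- Absolute continuity of the integral at a point of `[0, T]`. -/
theorem exists_window_setIntegral_lt (hT : 0 < T) {w : ℝ → ℝ} (hw : IntegrableOn w (Ioo 0 T))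
    {x : ℝ} (hx : x ∈ Icc 0 T) {ε : ℝ} (hε : 0 < ε) :
    ∃ δ > 0, ∃ α β : ℝ, 0 ≤ α ∧ α < β ∧ β ≤ T ∧ Ioo 0 T ∩ Metric.ball x δ ⊆ Ioo α β ∧
      ∫ r in Ioo α β, w r < ε := by
  have hc := continuousOn_primitive_Ioo hT.le hw x hx
  obtain ⟨δ, hδ, h⟩ := Metric.continuousWithinAt_iff.1 hc (ε / 2) (half_pos hε)
  have hαm : max 0 (x - δ / 2) ∈ Icc 0 T := ⟨le_max_left _ _, max_le hT.le (by linarith [hx.2])⟩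
  have hβm : min T (x + δ / 2) ∈ Icc 0 T := ⟨le_min hT.le (by linarith [hx.1]), min_le_left _ _⟩
  have hαβ : max 0 (x - δ / 2) < min T (x + δ / 2) :=
    max_lt (lt_min hT (by linarith [hx.1])) (lt_min (by linarith [hx.2]) (by linarith))
  refine ⟨δ / 2, half_pos hδ, max 0 (x - δ / 2), min T (x + δ / 2), hαm.1, hαβ, hβm.2, ?_, ?_⟩
  · rintro t ⟨ht, htb⟩
    rw [Metric.mem_ball, Real.dist_eq, abs_lt] at htb
    exact ⟨max_lt ht.1 (by linarith), lt_min ht.2 (by linarith)⟩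
  · have h1 := h hαm (by
      rw [Real.dist_eq, abs_lt]
      exact ⟨by linarith [le_max_right 0 (x - δ / 2)],
        (sub_nonpos.2 (max_le hx.1 (by linarith))).trans_lt hδ⟩)
    have h2 := h hβm (by
      rw [Real.dist_eq, abs_lt]
      exact ⟨by linarith [le_min hx.2 (show x ≤ x + δ / 2 by linarith)],
        by linarith [min_le_right T (x + δ / 2)]⟩)
    rw [Real.dist_eq, abs_lt] at h1 h2
    have h0 : (0 : ℝ) ∈ Icc 0 T := left_mem_Icc.2 hT.le
    rw [← integral_Ioc_eq_integral_Ioo, ← intervalIntegral.integral_of_le hαβ.le,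
      ← intervalIntegral.integral_interval_sub_left (intervalIntegrable_of_Ioo hw h0 hβm)
        (intervalIntegrable_of_Ioo hw h0 hαm)]
    linarith [h1.1, h2.2]

/-- Expanding the square, the energy identity and the primitive formula tested with `y s` combine to
`‖y t - y s‖_H² = 2∫ ⟨g r, y r - y s⟩` over `[s, t]`. The fixed `y s` is harmless because `havg`
bounds its `V`-norm by the mean over the window. -/
theorem norm_val_sub_sq_le {y : L2V T} {g : L2VDual T} {c : VDual} {K α β s t : ℝ}
    (hα : 0 ≤ α) (hβ : β ≤ T) (hs : s ∈ Ioo α β) (ht : t ∈ Ioo α β)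
    (hcs : embDual (y s) = c + ∫ r in (0 : ℝ)..s, g r)
    (hct : embDual (y t) = c + ∫ r in (0 : ℝ)..t, g r)
    (hKs : ‖V.val (y s)‖ ^ 2 = K + 2 * ∫ r in (0 : ℝ)..s, g r (y r))
    (hKt : ‖V.val (y t)‖ ^ 2 = K + 2 * ∫ r in (0 : ℝ)..t, g r (y r))
    (havg : (β - α) * ‖y s‖ ^ 2 ≤ ∫ r in Ioo α β, ‖y r‖ ^ 2) :
    ‖V.val (y t) - V.val (y s)‖ ^ 2 ≤ 2 * ∫ r in Ioo α β, (‖y r‖ ^ 2 + ‖g r‖ ^ 2) := by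
  have hsub : Ioo α β ⊆ Ioo 0 T := Ioo_subset_Ioo hα hβ
  have hsI := Ioo_subset_Icc_self (hsub hs)
  have htI := Ioo_subset_Icc_self (hsub ht)
  have h0 : (0 : ℝ) ∈ Icc 0 T := ⟨le_rfl, hsI.1.trans hsI.2⟩
  have hP : IntegrableOn (fun r => g r (y r)) (Ioo 0 T) :=
    integrable_pairing (Lp.memLp g) (Lp.memLp y)
  have hg := integrable_Lp_time g
  have hgs : IntegrableOn (fun r => g r (y s)) (Ioo 0 T) := by
    exact (ContinuousLinearMap.apply ℝ ℝ (y s)).integrable_comp hg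
  have hyy : IntegrableOn (fun r => ‖y r‖ ^ 2) (Ioo α β) :=
    IntegrableOn.mono_set (t := Ioo 0 T) (MemLp.integrable_norm_sq (Lp.memLp y)) hsub
  have hgg : IntegrableOn (fun r => ‖g r‖ ^ 2) (Ioo α β) :=
    IntegrableOn.mono_set (t := Ioo 0 T) (MemLp.integrable_norm_sq (Lp.memLp g)) hsub
  have e1 : ‖V.val (y t) - V.val (y s)‖ ^ 2 = 2 * ∫ r in s..t, (g r (y r) - g r (y s)) := by
    have h1 : inner ℝ (V.val (y t)) (V.val (y s)) = embDual (y t) (y s) := rfl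
    have h2 : embDual (y t) (y s) = embDual (y s) (y s) + (∫ r in s..t, g r) (y s) := by
      rw [hct, hcs, ← intervalIntegral.integral_add_adjacent_intervals (b := s)
        (intervalIntegrable_of_Ioo hg h0 hsI) (intervalIntegrable_of_Ioo hg hsI htI), ← add_assoc,
        add_apply]
    rw [intervalIntegral.integral_sub (intervalIntegrable_of_Ioo hP hsI htI)
      (intervalIntegrable_of_Ioo hgs hsI htI),
      ← intervalIntegral_dual_apply (intervalIntegrable_of_Ioo hg hsI htI),
      ← intervalIntegral.integral_interval_sub_left (intervalIntegrable_of_Ioo hP h0 htI)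
        (intervalIntegrable_of_Ioo hP h0 hsI), norm_sub_sq_real, h1, h2, embDual_self]
    linarith
  have hb : ∀ r, ‖g r (y r) - g r (y s)‖ ≤ ‖g r‖ ^ 2 + (‖y r‖ ^ 2 + ‖y s‖ ^ 2) / 2 := fun r => by
    refine (norm_sub_le _ _).trans ((add_le_add ((g r).le_opNorm _) ((g r).le_opNorm _)).trans ?_)
    nlinarith [sq_nonneg (‖g r‖ - ‖y r‖), sq_nonneg (‖g r‖ - ‖y s‖)]
  have hcst : IntegrableOn (fun _ => ‖y s‖ ^ 2) (Ioo α β) := integrableOn_const (by simp)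
  have hys : IntegrableOn (fun r => (‖y r‖ ^ 2 + ‖y s‖ ^ 2) / 2) (Ioo α β) :=
    (hyy.add hcst).div_const 2
  have hib : IntegrableOn (fun r => ‖g r‖ ^ 2 + (‖y r‖ ^ 2 + ‖y s‖ ^ 2) / 2) (Ioo α β) :=
    hgg.add hys
  have h2 : ∫ r in s..t, (g r (y r) - g r (y s))
      ≤ ∫ r in Ioo α β, (‖g r‖ ^ 2 + (‖y r‖ ^ 2 + ‖y s‖ ^ 2) / 2) := by
    refine (le_abs_self _).trans ?_
    rw [← Real.norm_eq_abs]
    refine intervalIntegral.norm_integral_le_integral_norm_uIoc.trans ?_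
    have hu : uIoc s t ⊆ Ioo α β := fun r hr => by
      rcases uIoc_eq_union (a := s) (b := t) ▸ hr with h | h
      · exact ⟨hs.1.trans h.1, h.2.trans_lt ht.2⟩
      · exact ⟨ht.1.trans h.1, h.2.trans_lt hs.2⟩
    refine (setIntegral_mono (IntegrableOn.mono_set (t := Ioo 0 T) (hP.sub hgs).norm
      (hu.trans hsub)) (hib.mono_set hu)
      hb).trans (setIntegral_mono_set hib (Eventually.of_forall fun r => ?_) (LE.le.eventuallyLE hu))
    exact (norm_nonneg _).trans (hb r)
  have h3 : ∫ r in Ioo α β, (‖g r‖ ^ 2 + (‖y r‖ ^ 2 + ‖y s‖ ^ 2) / 2)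
      = (∫ r in Ioo α β, ‖g r‖ ^ 2) + ((∫ r in Ioo α β, ‖y r‖ ^ 2) + (β - α) * ‖y s‖ ^ 2) / 2 := by
    rw [integral_add hgg hys, integral_div, integral_add hyy hcst]
    simp [(hs.1.trans hs.2).le]
  rw [integral_add hyy hgg, e1]
  linarith

/-- Elements of `W(V)` have a representative in `C([0, T]; H)`. -/
theorem exists_isContRep (hT : 0 < T) (y : W T) : ∃ Y : ℝ → H, IsContRep y Y := by
  have hy : HasTimeDeriv T y.toL2V y.dt := y.2
  obtain ⟨c, hc⟩ := hy.ae_eq_primitive hT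
  obtain ⟨K, hK⟩ := hy.ae_energy_eq hT
  set A : Set ℝ := {t | t ∈ Ioo 0 T ∧ embDual (y.toL2V t) = c + ∫ r in (0 : ℝ)..t, y.dt r ∧
    ‖V.val (y.toL2V t)‖ ^ 2 = K + 2 * ∫ r in (0 : ℝ)..t, y.dt r (y.toL2V r)} with hA
  have hAae : ∀ᵐ t ∂(timeMeasure T), t ∈ A := by
    filter_upwards [hc, hK, ae_restrict_mem measurableSet_Ioo] with t h1 h2 h3
    exact ⟨h3, h1, h2⟩
  have hyy : IntegrableOn (fun r => ‖y.toL2V r‖ ^ 2) (Ioo 0 T) :=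
    MemLp.integrable_norm_sq (Lp.memLp y.toL2V)
  have hgg : IntegrableOn (fun r => ‖y.dt r‖ ^ 2) (Ioo 0 T) :=
    MemLp.integrable_norm_sq (Lp.memLp y.dt)
  have hJ : ∀ {α β : ℝ}, 0 ≤ α → α < β → β ≤ T →
      ∃ s ∈ A, s ∈ Ioo α β ∧ (β - α) * ‖y.toL2V s‖ ^ 2 ≤ ∫ r in Ioo α β, ‖y.toL2V r‖ ^ 2 := by
    intro α β hα hαβ hβ
    have hsub : Ioo α β ⊆ Ioo 0 T := Ioo_subset_Ioo hα hβ
    have h1 : ∀ᵐ t ∂(volume.restrict (Ioo α β)), t ∈ A ∧ t ∈ Ioo α β :=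
      (ae_restrict_of_ae_restrict_of_subset hsub hAae).and (ae_restrict_mem measurableSet_Ioo)
    obtain ⟨s, hs, hle⟩ := exists_notMem_null_le_average (μ := volume.restrict (Ioo α β))
      (by rw [Ne, Measure.restrict_eq_zero]; simp [hαβ]) (hyy.mono_set hsub) (ae_iff.1 h1)
    simp only [mem_ofPred_eq, not_not] at hs
    refine ⟨s, hs.1, hs.2, ?_⟩
    rw [setAverage_eq, Real.volume_real_Ioo_of_le hαβ.le, smul_eq_mul] at hle
    rwa [← le_inv_mul_iff₀ (sub_pos.2 hαβ)]
  have hclose : ∀ x ∈ Icc 0 T, ∀ ε > 0, ∃ δ > 0, ∀ t ∈ A, ∀ t' ∈ A, t ∈ Metric.ball x δ →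
      t' ∈ Metric.ball x δ → dist (V.val (y.toL2V t)) (V.val (y.toL2V t')) < ε := by
    intro x hx ε hε
    obtain ⟨δ, hδ, α, β, hα, hαβ, hβ, hsub, hint⟩ := exists_window_setIntegral_lt hT
      -- The factor `2` of `norm_val_sub_sq_le` turns `ε² / 8` into `(ε / 2)²`.
      (hyy.add hgg) hx (ε := ε ^ 2 / 8) (by positivity)
    obtain ⟨s, hsA, hs, havg⟩ := hJ hα hαβ hβ
    have hest : ∀ t ∈ A, t ∈ Metric.ball x δ → dist (V.val (y.toL2V t)) (V.val (y.toL2V s)) < ε / 2 := by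
      intro t htA htb
      have := norm_val_sub_sq_le hα hβ hs (hsub ⟨htA.1, htb⟩) hsA.2.1 htA.2.1 hsA.2.2 htA.2.2 havg
      rw [dist_eq_norm]
      refine lt_of_pow_lt_pow_left₀ 2 (by positivity) (this.trans_lt ?_)
      simp only [Pi.add_apply] at hint
      linarith
    refine ⟨δ, hδ, fun t ht t' ht' htb htb' => ?_⟩
    refine (dist_triangle_right _ _ (V.val (y.toL2V s))).trans_lt ?_
    linarith [hest t ht htb, hest t' ht' htb']
  have hdense : Icc 0 T ⊆ closure A := by
    intro x hx
    rw [Metric.mem_closure_iff]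
    intro ε hε
    obtain ⟨s, hsA, hs, -⟩ := hJ (α := max 0 (x - ε / 2)) (β := min T (x + ε / 2)) (le_max_left _ _)
      (max_lt (lt_min hT (by linarith [hx.1])) (lt_min (by linarith [hx.2]) (by linarith)))
      (min_le_left _ _)
    refine ⟨s, hsA, ?_⟩
    rw [Real.dist_eq, abs_lt]
    exact ⟨by linarith [hs.2.trans_le (min_le_right T (x + ε / 2))],
      by linarith [(le_max_right 0 (x - ε / 2)).trans_lt hs.1]⟩
  have hlim : ∀ x ∈ Icc 0 T, ∃ z, Tendsto (fun t => V.val (y.toL2V t)) (𝓝[A] x) (𝓝 z) := by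
    intro x hx
    have : (𝓝[A] x).NeBot := mem_closure_iff_nhdsWithin_neBot.1 (hdense hx)
    refine cauchy_map_iff_exists_tendsto.1 (Metric.cauchy_iff.2 ⟨inferInstance, fun ε hε => ?_⟩)
    obtain ⟨δ, hδ, h⟩ := hclose x hx ε hε
    refine ⟨_, image_mem_map (inter_mem_nhdsWithin A (Metric.ball_mem_nhds x hδ)), ?_⟩
    rintro _ ⟨t, ht, rfl⟩ _ ⟨t', ht', rfl⟩
    exact h t ht.1 t' ht'.1 ht.2 ht'.2
  refine ⟨extendFrom A fun t => V.val (y.toL2V t), continuousOn_extendFrom hdense hlim, ?_⟩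
  filter_upwards [hAae] with t ht
  obtain ⟨z, hz⟩ := hlim t (Ioo_subset_Icc_self ht.1)
  rw [extendFrom_eq (subset_closure ht) hz]
  exact tendsto_nhds_unique (hz.mono_left (pure_le_nhdsWithin ht)) (tendsto_pure_nhds _ t)

end ContinuousRepresentative

/-! ### Values at the final time -/

section Trace

variable {T : ℝ}

theorem eqOn_Icc_of_ae_timeMeasure (hT : 0 < T) {E : Type*} [TopologicalSpace E] [T2Space E]
    {f k : ℝ → E} (h : ∀ᵐ t ∂(timeMeasure T), f t = k t) (hf : ContinuousOn f (Icc 0 T))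
    (hk : ContinuousOn k (Icc 0 T)) : EqOn f k (Icc 0 T) := by
  refine Measure.eqOn_Icc_of_ae_eq volume hT.ne ?_ hf hk
  rw [← Measure.restrict_congr_set (Ioo_ae_eq_Icc (μ := volume) (a := (0 : ℝ)) (b := T))]
  exact h

theorem IsContRep.eqOn (hT : 0 < T) {y : W T} {Y Z : ℝ → H} (hY : IsContRep y Y)
    (hZ : IsContRep y Z) : EqOn Y Z (Icc 0 T) := by
  refine eqOn_Icc_of_ae_timeMeasure hT ?_ hY.1 hZ.1
  filter_upwards [hY.2, hZ.2] with t h1 h2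
  rw [h1, h2]

theorem IsContRep.eq_valueAt (hT : 0 < T) {y : W T} {Y : ℝ → H} (hY : IsContRep y Y) {t : ℝ}
    (ht : t ∈ Icc 0 T) : Y t = y.valueAt t := by
  have h : ∃ Y : ℝ → H, IsContRep y Y := ⟨Y, hY⟩
  rw [W.valueAt, dif_pos h]
  exact hY.eqOn hT h.choose_spec ht

theorem valueAt_sub (hT : 0 < T) (y z : W T) {t : ℝ} (ht : t ∈ Icc 0 T) :
    (y - z).valueAt t = y.valueAt t - z.valueAt t := by
  obtain ⟨Y, hY⟩ := exists_isContRep hT y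
  obtain ⟨Z, hZ⟩ := exists_isContRep hT z
  have h : IsContRep (y - z) (Y - Z) := by
    refine ⟨hY.1.sub hZ.1, ?_⟩
    filter_upwards [hY.2, hZ.2, Lp.coeFn_sub y.toL2V z.toL2V] with t h1 h2 h3
    rw [show (y - z).toL2V = y.toL2V - z.toL2V from rfl, h3, Pi.sub_apply, Pi.sub_apply, map_sub,
      h1, h2]
  rw [← h.eq_valueAt hT ht, ← hY.eq_valueAt hT ht, ← hZ.eq_valueAt hT ht, Pi.sub_apply]

theorem integrable_dt_apply (y : W T) :
    IntegrableOn (fun r => y.dt r (y.toL2V r)) (Ioo 0 T) :=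
  integrable_pairing (Lp.memLp y.dt) (Lp.memLp y.toL2V)

/-- The energy identity in `W(V)`. -/
theorem IsContRep.energy_eq (hT : 0 < T) {y : W T} {Y : ℝ → H} (hY : IsContRep y Y) {t : ℝ}
    (ht : t ∈ Icc 0 T) :
    ‖Y t‖ ^ 2 = ‖Y T‖ ^ 2 - 2 * ∫ r in t..T, y.dt r (y.toL2V r) := by
  have hy : HasTimeDeriv T y.toL2V y.dt := y.2
  obtain ⟨K, hK⟩ := hy.ae_energy_eq hT
  have hP := integrable_dt_apply y
  have heq : EqOn (fun t => ‖Y t‖ ^ 2) (fun t => K + 2 * ∫ r in (0 : ℝ)..t, y.dt r (y.toL2V r))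
      (Icc 0 T) := by
    refine eqOn_Icc_of_ae_timeMeasure hT ?_ (hY.1.norm.pow 2)
      (continuousOn_const.add (continuousOn_const.mul (continuousOn_primitive_Ioo hT.le hP)))
    filter_upwards [hK, hY.2] with t h1 h2
    rw [h2, h1]
  have hT' : T ∈ Icc 0 T := right_mem_Icc.2 hT.le
  have h0 : (0 : ℝ) ∈ Icc 0 T := left_mem_Icc.2 hT.le
  have h1 := heq ht
  have h2 := heq hT'
  simp only at h1 h2
  rw [h1, h2, ← intervalIntegral.integral_interval_sub_left (intervalIntegrable_of_Ioo hP h0 hT')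
    (intervalIntegrable_of_Ioo hP h0 ht)]
  ring

theorem W.norm_sq_eq (y : W T) : ‖y‖ ^ 2 = ‖y.toL2V‖ ^ 2 + ‖y.dt‖ ^ 2 :=
  WithLp.prod_norm_sq_eq_of_L2 y.1

theorem two_mul_integral_dt_le (y : W T) {t : ℝ} (ht : t ∈ Icc 0 T) :
    2 * ∫ r in t..T, y.dt r (y.toL2V r) ≤ ‖y‖ ^ 2 := by
  have h1 : ∫ r in t..T, y.dt r (y.toL2V r) ≤ ‖y.dt‖ * ‖y.toL2V‖ := by
    rw [intervalIntegral.integral_of_le ht.2, integral_Ioc_eq_integral_Ioo,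
      show Ioo t T = Ioo t T ∩ Ioo 0 T from
        (inter_eq_left.2 (Ioo_subset_Ioo_left ht.1)).symm,
      ← Measure.restrict_restrict measurableSet_Ioo]
    exact (le_abs_self _).trans (norm_setIntegral_pairing_le y.dt y.toL2V (Ioo t T))
  rw [y.norm_sq_eq]
  nlinarith [sq_nonneg (‖y.dt‖ - ‖y.toL2V‖)]

/-- The energy identity gives `‖y(T)‖² ≤ ‖y(t)‖_V² + ‖y‖_{W(V)}²` for almost every `t`; averaging
over `t ∈ (0, T)` produces the `1 / T`. -/
theorem norm_valueAt_sq_le (hT : 0 < T) (y : W T) :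
    ‖y.valueAt T‖ ^ 2 ≤ (1 / T + 1) * ‖y‖ ^ 2 := by
  obtain ⟨Y, hY⟩ := exists_isContRep hT y
  rw [← hY.eq_valueAt hT (right_mem_Icc.2 hT.le)]
  have hyy : IntegrableOn (fun r => ‖y.toL2V r‖ ^ 2) (Ioo 0 T) :=
    MemLp.integrable_norm_sq (Lp.memLp y.toL2V)
  have h1 : ∫ _ in Ioo 0 T, ‖Y T‖ ^ 2 ≤ ∫ t in Ioo 0 T, (‖y.toL2V t‖ ^ 2 + ‖y‖ ^ 2) := by
    refine integral_mono_ae (integrable_const _) (hyy.add (integrable_const _)) ?_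
    filter_upwards [hY.2, ae_restrict_mem measurableSet_Ioo] with t h2 ht
    have h3 := hY.energy_eq hT (Ioo_subset_Icc_self ht)
    have h4 := two_mul_integral_dt_le y (Ioo_subset_Icc_self ht)
    have h5 : ‖Y t‖ ^ 2 ≤ ‖y.toL2V t‖ ^ 2 := by
      rw [h2]
      gcongr
      exact V.norm_val_le _
    linarith
  rw [integral_add hyy (integrable_const _), ← Lp_norm_sq_eq_integral] at h1
  simp only [integral_const, measureReal_restrict_apply_univ, Real.volume_real_Ioo_of_le hT.le,
    sub_zero, smul_eq_mul] at h1
  have h2 : ‖y.toL2V‖ ^ 2 ≤ ‖y‖ ^ 2 := by rw [y.norm_sq_eq]; linarith [sq_nonneg ‖y.dt‖]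
  refine le_of_mul_le_mul_left ?_ hT
  have : T * ((1 / T + 1) * ‖y‖ ^ 2) = ‖y‖ ^ 2 + T * ‖y‖ ^ 2 := by field_simp
  rw [this]
  linarith

theorem norm_valueAt_le_of_ae (hT : 0 < T) {y : W T} {m : ℝ}
    (h : ∀ᵐ t ∂(timeMeasure T), ‖y.toL2V t‖ ≤ m) : ‖y.valueAt T‖ ≤ m := by
  obtain ⟨Y, hY⟩ := exists_isContRep hT y
  rw [← hY.eq_valueAt hT (right_mem_Icc.2 hT.le)]
  -- Writing the inequality as the equality `max ‖Y t‖ m = m` of continuous functions carries it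
  -- from almost every time to `T`.
  have heq : EqOn (fun t => max ‖Y t‖ m) (fun _ => m) (Icc 0 T) := by
    refine eqOn_Icc_of_ae_timeMeasure hT ?_ (ContinuousOn.sup hY.1.norm continuousOn_const) continuousOn_const
    filter_upwards [hY.2, h] with t h1 h2
    rw [h1]
    exact max_eq_right ((V.norm_val_le _).trans h2)
  exact max_eq_right_iff.1 (heq (right_mem_Icc.2 hT.le))

end Trace

/-! ### Backward Gronwall inequality -/

section Gronwall

/-- A backward Gronwall inequality with an integrable coefficient. -/
theorem gronwall_backward {T K : ℝ} {a e : ℝ → ℝ} (hT : 0 ≤ T)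
    (ha : IntegrableOn a (Ioo 0 T)) (ha0 : ∀ t, 0 ≤ a t) (he0 : ∀ t, 0 ≤ e t)
    (hae : IntegrableOn (fun t => a t * e t) (Ioo 0 T))
    (hle : ∀ t ∈ Icc 0 T, e t ≤ K + ∫ r in t..T, a r * e r) :
    ∀ (n : ℕ), ∀ t ∈ Icc 0 T, ∫ r in t..T, a r ≤ n / 2 →
      K + ∫ r in t..T, a r * e r ≤ 2 ^ n * K := by
  have hT' : T ∈ Icc 0 T := right_mem_Icc.2 hT
  have ii : ∀ {s t}, s ∈ Icc 0 T → t ∈ Icc 0 T → IntervalIntegrable a volume s t := fun hs ht =>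
    intervalIntegrable_of_Ioo ha hs ht
  have jj : ∀ {s t}, s ∈ Icc 0 T → t ∈ Icc 0 T →
      IntervalIntegrable (fun t => a t * e t) volume s t := fun hs ht =>
    intervalIntegrable_of_Ioo hae hs ht
  -- With `u t = K + ∫ a e` over `[t, T]`, which decreases in `t`, this is `u t ≤ u r + (∫ a) u t`,
  -- the integral being over `[t, r]`. When that integral is at most `1/2`, `u` at most doubles; `n`
  -- counts the doublings.
  have hstep : ∀ t ∈ Icc 0 T, ∀ r ∈ Icc 0 T, t ≤ r → K + ∫ s in t..T, a s * e s
      ≤ (K + ∫ s in r..T, a s * e s) + (∫ s in t..r, a s) * (K + ∫ s in t..T, a s * e s) := by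
    intro t ht r hr htr
    have h1 : ∫ s in t..r, a s * e s ≤ ∫ s in t..r, a s * (K + ∫ s in t..T, a s * e s) := by
      refine intervalIntegral.integral_mono_on htr (jj ht hr) ((ii ht hr).mul_const _) fun s hs => ?_
      have hsI : s ∈ Icc 0 T := ⟨ht.1.trans hs.1, hs.2.trans hr.2⟩
      refine mul_le_mul_of_nonneg_left ((hle s hsI).trans ?_) (ha0 s)
      rw [← intervalIntegral.integral_add_adjacent_intervals (jj ht hsI) (jj hsI hT')]
      have := intervalIntegral.integral_nonneg (μ := volume) hs.1
        fun r _ => mul_nonneg (ha0 r) (he0 r)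
      linarith
    rw [intervalIntegral.integral_mul_const] at h1
    have h2 := intervalIntegral.integral_add_adjacent_intervals (jj ht hr) (jj hr hT')
    linarith
  have hu0 : ∀ t ∈ Icc 0 T, 0 ≤ K + ∫ s in t..T, a s * e s := fun t ht => (he0 t).trans (hle t ht)
  intro n
  induction n with
  | zero =>
    intro t ht h
    have h1 := hstep t ht T hT' ht.2
    rw [intervalIntegral.integral_same, add_zero] at h1
    have h2 : (∫ s in t..T, a s) * (K + ∫ s in t..T, a s * e s) ≤ 0 :=
      mul_nonpos_of_nonpos_of_nonneg (by simpa using h) (hu0 t ht)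
    rw [pow_zero, one_mul]
    linarith
  | succ n ih =>
    intro t ht h
    have hK : 0 ≤ K := by simpa using hu0 T hT'
    rcases le_total (∫ r in t..T, a r) (n / 2) with hn | hn
    · refine (ih t ht hn).trans (mul_le_mul_of_nonneg_right ?_ hK)
      exact pow_le_pow_right₀ one_le_two n.le_succ
    · have hcont : ContinuousOn (fun r => ∫ s in r..T, a s) (Icc t T) := by
        have h1 := (continuousOn_primitive_Ioo hT ha).mono (Icc_subset_Icc_left ht.1)
        refine ((continuousOn_const (c := ∫ s in (0 : ℝ)..T, a s)).sub h1).congr fun r hr => ?_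
        have hrI : r ∈ Icc 0 T := ⟨ht.1.trans hr.1, hr.2⟩
        exact (intervalIntegral.integral_interval_sub_left (ii (left_mem_Icc.2 hT) hT')
          (ii (left_mem_Icc.2 hT) hrI)).symm
      -- Cut at the time where the remaining mass of `a` is exactly `n / 2`; the mass left on `[t,
      -- r]` is then at most `1/2`.
      obtain ⟨r, hr, hrn⟩ := intermediate_value_Icc' ht.2 hcont
        (show (n / 2 : ℝ) ∈ Icc _ _ from ⟨by
          rw [intervalIntegral.integral_same]; positivity, hn⟩)
      have hrI : r ∈ Icc 0 T := ⟨ht.1.trans hr.1, hr.2⟩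
      have h1 := ih r hrI hrn.le
      have h2 := hstep t ht r hrI hr.1
      have h3 := intervalIntegral.integral_add_adjacent_intervals (ii ht hrI) (ii hrI hT')
      simp only at hrn
      push_cast at h
      have h4 : ∫ s in t..r, a s ≤ 1 / 2 := by linarith
      have h5 := mul_le_mul_of_nonneg_right h4 (hu0 t ht)
      rw [pow_succ]
      linarith

end Gronwall

/-! ### The energy estimate -/

section EnergyEstimate

variable {T : ℝ}

theorem energy_estimate (hT : 0 < T) {ν : ℝ} {p : W T} {a b : ℝ → ℝ} (hν : 0 < ν)
    (ha : IntegrableOn a (Ioo 0 T)) (ha0 : ∀ t, 0 ≤ a t)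
    (hb : IntegrableOn b (Ioo 0 T)) (hb0 : ∀ t, 0 ≤ b t)
    (h : ∀ᵐ t ∂(timeMeasure T), ν * ‖V.dx (p.toL2V t)‖ ^ 2 - a t * ‖V.val (p.toL2V t)‖ ^ 2 - b t
      ≤ 2 * p.dt t (p.toL2V t)) {n : ℕ} (hn : ∫ t in Ioo 0 T, a t ≤ n / 2) :
    (∀ᵐ t ∂(timeMeasure T),
      ‖V.val (p.toL2V t)‖ ^ 2 ≤ 2 ^ n * (‖p.valueAt T‖ ^ 2 + ∫ t in Ioo 0 T, b t)) ∧
    ν * ∫ t in Ioo 0 T, ‖V.dx (p.toL2V t)‖ ^ 2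
      ≤ 2 ^ n * (‖p.valueAt T‖ ^ 2 + ∫ t in Ioo 0 T, b t) := by
  obtain ⟨Y, hY⟩ := exists_isContRep hT p
  have hT' : T ∈ Icc 0 T := right_mem_Icc.2 hT.le
  have h0' : (0 : ℝ) ∈ Icc 0 T := left_mem_Icc.2 hT.le
  rw [← hY.eq_valueAt hT hT']
  set K := ‖Y T‖ ^ 2 + ∫ t in Ioo 0 T, b t with hK
  have hdx : IntegrableOn (fun t => ‖V.dx (p.toL2V t)‖ ^ 2) (Ioo 0 T) :=
    MemLp.integrable_norm_sq (V.dx.comp_memLp' (Lp.memLp p.toL2V))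
  have hae : IntegrableOn (fun t => a t * ‖Y t‖ ^ 2) (Ioo 0 T) := by
    have hc : ContinuousOn (fun t => ‖Y t‖ ^ 2) (Icc 0 T) := hY.1.norm.pow 2
    have := ((integrableOn_Icc_iff_integrableOn_Ioo).2 ha).mul_continuousOn hc isCompact_Icc
    exact (integrableOn_Icc_iff_integrableOn_Ioo).1 this
  have hnonneg : ∀ {f : ℝ → ℝ}, (∀ t, 0 ≤ f t) → ∀ t ∈ Icc 0 T, 0 ≤ ∫ r in t..T, f r :=
    fun hf t ht => intervalIntegral.integral_nonneg ht.2 fun r _ => hf r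
  have hmono : ∀ {f : ℝ → ℝ}, IntegrableOn f (Ioo 0 T) → (∀ t, 0 ≤ f t) → ∀ t ∈ Icc 0 T,
      ∫ r in t..T, f r ≤ ∫ r in Ioo 0 T, f r := by
    intro f hf hf0 t ht
    rw [intervalIntegral.integral_of_le ht.2, integral_Ioc_eq_integral_Ioo]
    exact setIntegral_mono_set hf (Eventually.of_forall hf0)
      (LE.le.eventuallyLE (Ioo_subset_Ioo_left ht.1))
  have key : ∀ t ∈ Icc 0 T, ‖Y t‖ ^ 2 + ν * ∫ r in t..T, ‖V.dx (p.toL2V r)‖ ^ 2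
      ≤ K + ∫ r in t..T, a r * ‖Y r‖ ^ 2 := by
    intro t ht
    have i1 := (intervalIntegrable_of_Ioo hdx ht hT').const_mul ν
    have i2 := intervalIntegrable_of_Ioo hae ht hT'
    have i3 := intervalIntegrable_of_Ioo hb ht hT'
    have hle : ∫ r in t..T, (ν * ‖V.dx (p.toL2V r)‖ ^ 2 - a r * ‖Y r‖ ^ 2 - b r)
        ≤ ∫ r in t..T, 2 * p.dt r (p.toL2V r) := by
      rw [intervalIntegral.integral_of_le ht.2, intervalIntegral.integral_of_le ht.2,
        integral_Ioc_eq_integral_Ioo, integral_Ioc_eq_integral_Ioo]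
      have hsub : Ioo t T ⊆ Ioo 0 T := Ioo_subset_Ioo_left ht.1
      have j1 : IntegrableOn (fun r => ν * ‖V.dx (p.toL2V r)‖ ^ 2 - a r * ‖Y r‖ ^ 2 - b r)
        (Ioo 0 T) := ((hdx.const_mul ν).sub hae).sub hb
      have j2 : IntegrableOn (fun r => 2 * p.dt r (p.toL2V r)) (Ioo 0 T) :=
        (integrable_dt_apply p).const_mul 2
      refine integral_mono_ae (j1.mono_set hsub) (j2.mono_set hsub) ?_
      refine ae_restrict_of_ae_restrict_of_subset hsub ?_
      filter_upwards [h, hY.2] with r h1 h2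
      rwa [h2]
    rw [intervalIntegral.integral_sub (i1.sub i2) i3, intervalIntegral.integral_sub i1 i2,
      intervalIntegral.integral_const_mul, intervalIntegral.integral_const_mul] at hle
    have h1 := hY.energy_eq hT ht
    have h2 := hmono hb hb0 t ht
    linarith
  have hdx0 := hnonneg (f := fun r => ‖V.dx (p.toL2V r)‖ ^ 2) fun r => by positivity
  have hgr : ∀ t ∈ Icc 0 T, K + ∫ r in t..T, a r * ‖Y r‖ ^ 2 ≤ 2 ^ n * K := fun t ht =>
    gronwall_backward hT.le ha ha0 (fun r => by positivity) hae
      (fun t ht => by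
        have := mul_nonneg hν.le (hdx0 t ht)
        linarith [key t ht]) n t ht ((hmono ha ha0 t ht).trans hn)
  constructor
  · filter_upwards [hY.2, ae_restrict_mem measurableSet_Ioo] with t h1 ht
    have htI := Ioo_subset_Icc_self ht
    rw [← h1]
    linarith [key t htI, hgr t htI, mul_nonneg hν.le (hdx0 t htI)]
  · have h1 := key 0 h0'
    rw [intervalIntegral.integral_of_le (f := fun r => ‖V.dx (p.toL2V r)‖ ^ 2) hT.le,
      integral_Ioc_eq_integral_Ioo] at h1
    linarith [hgr 0 h0', sq_nonneg ‖Y 0‖]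

end EnergyEstimate

/-! ### Stability of the adjoint equation -/

section Adjoint

variable {ν T : ℝ}

theorem IsAdjointSolution.valueAt_eq {y_d : H} {y p : W T}
    (h : IsAdjointSolution ν T y_d y p) : p.valueAt T = y_d - y.valueAt T :=
  ext_inner_right ℝ h.terminal

theorem integrable_norm_sq_Lp_time {E : Type*} [NormedAddCommGroup E] (f : Lp E 2 (timeMeasure T)) :
    IntegrableOn (fun t => ‖f t‖ ^ 2) (Ioo 0 T) :=
  MemLp.integrable_norm_sq (Lp.memLp f)

theorem integrable_norm_dx_sq (p : L2V T) :
    IntegrableOn (fun t => ‖V.dx (p t)‖ ^ 2) (Ioo 0 T) :=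
  MemLp.integrable_norm_sq (V.dx.comp_memLp' (Lp.memLp p))

theorem integrable_norm_val_sq (p : L2V T) :
    IntegrableOn (fun t => ‖V.val (p t)‖ ^ 2) (Ioo 0 T) :=
  MemLp.integrable_norm_sq (V.val.comp_memLp' (Lp.memLp p))

theorem norm_L2V_sq_eq (p : L2V T) :
    ‖p‖ ^ 2 = (∫ t in Ioo 0 T, ‖V.val (p t)‖ ^ 2) + ∫ t in Ioo 0 T, ‖V.dx (p t)‖ ^ 2 := by
  rw [Lp_norm_sq_eq_integral, ← integral_add (integrable_norm_val_sq p) (integrable_norm_dx_sq p)]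
  simp only [V.norm_sq_eq]

theorem ae_norm_le_of_normLinftyV {y : W T} {M : ℝ} (h : y.normLinftyV ≤ ENNReal.ofReal M) :
    ∀ᵐ t ∂(timeMeasure T), ‖y.toL2V t‖ ≤ |M| := by
  rw [W.normLinftyV, eLpNorm_exponent_top] at h
  filter_upwards [ae_le_eLpNormEssSup (f := y.toL2V) (μ := timeMeasure T)] with t ht
  -- `ENNReal.ofReal` truncates a negative `M` to zero, so `|M|` is a valid bound for either sign.
  have h1 := (ht.trans h).trans (ENNReal.ofReal_le_ofReal (le_abs_self M))
  rwa [← ofReal_norm, ENNReal.ofReal_le_ofReal_iff (abs_nonneg M)] at h1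

theorem norm_toL2V_sq_le (hT : 0 < T) {y : W T} {M : ℝ}
    (h : y.normLinftyV ≤ ENNReal.ofReal M ∨ ‖y‖ ≤ M) : ‖y.toL2V‖ ^ 2 ≤ (T + 1) * M ^ 2 := by
  rcases h with h | h
  · rw [Lp_norm_sq_eq_integral]
    have h1 : ∫ t in Ioo 0 T, ‖y.toL2V t‖ ^ 2 ≤ ∫ _ in Ioo 0 T, M ^ 2 := by
      refine integral_mono_ae (integrable_norm_sq_Lp_time _) (integrable_const _) ?_
      filter_upwards [ae_norm_le_of_normLinftyV h] with t ht
      rw [← sq_abs M]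
      gcongr
    refine h1.trans ?_
    simp only [integral_const, measureReal_restrict_apply_univ, Real.volume_real_Ioo_of_le hT.le,
      sub_zero, smul_eq_mul]
    nlinarith [sq_nonneg M]
  · have h1 : ‖y‖ ^ 2 ≤ M ^ 2 := by gcongr
    rw [y.norm_sq_eq] at h1
    nlinarith [sq_nonneg ‖y.dt‖, mul_nonneg hT.le (sq_nonneg M)]

theorem norm_valueAt_sq_le_of_bounded (hT : 0 < T) {y : W T} {M : ℝ}
    (h : y.normLinftyV ≤ ENNReal.ofReal M ∨ ‖y‖ ≤ M) :
    ‖y.valueAt T‖ ^ 2 ≤ (1 / T + 1) * M ^ 2 := by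
  rcases h with h | h
  · have h1 := norm_valueAt_le_of_ae hT (ae_norm_le_of_normLinftyV h)
    have h2 : ‖y.valueAt T‖ ^ 2 ≤ M ^ 2 := by rw [← sq_abs M]; gcongr
    have : 0 ≤ 1 / T * M ^ 2 := by positivity
    linarith
  · refine (norm_valueAt_sq_le hT y).trans ?_
    gcongr

theorem convection_young (hν : 0 < ν) (u v d : ℝ) :
    4 * (u * (v * d)) ≤ ν * v ^ 2 + 4 / ν * u ^ 2 * d ^ 2 := by
  have h : 0 ≤ (ν * v - 2 * (u * d)) ^ 2 / ν := by positivity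
  have e : (ν * v - 2 * (u * d)) ^ 2 / ν
      = ν * v ^ 2 + 4 / ν * u ^ 2 * d ^ 2 - 4 * (u * (v * d)) := by field_simp; ring
  linarith

theorem IsAdjointSolution.integral_norm_dx_sq_le (hν : 0 < ν) (hT : 0 < T) {y_d : H} {y p : W T}
    (h : IsAdjointSolution ν T y_d y p) {n : ℕ} (hn : 4 / ν * ‖y.toL2V‖ ^ 2 ≤ n / 2) :
    ν * ∫ t in Ioo 0 T, ‖V.dx (p.toL2V t)‖ ^ 2 ≤ 2 ^ n * ‖y_d - y.valueAt T‖ ^ 2 := by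
  have := (energy_estimate hT (p := p) (a := fun t => 4 / ν * ‖y.toL2V t‖ ^ 2) (b := fun _ => 0) hν
    ((integrable_norm_sq_Lp_time _).const_mul _) (fun t => by positivity)
    (integrableOn_const (by simp)) (fun _ => le_rfl) ?_ (n := n) ?_).2
  · simpa [h.valueAt_eq] using this
  · filter_upwards [h.ae_forall] with t ht
    have h1 := ht (p.toL2V t)
    have h2 := abs_integral_convection_le (y.toL2V t) (V.dx (p.toL2V t)) (V.val (p.toL2V t))
    have h3 := convection_young hν ‖y.toL2V t‖ ‖V.dx (p.toL2V t)‖ ‖V.val (p.toL2V t)‖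
    rw [real_inner_self_eq_norm_sq] at h1
    linarith [le_abs_self
      (∫ x, V.val (y.toL2V t) x * V.dx (p.toL2V t) x * V.val (p.toL2V t) x)]
  · rwa [integral_const_mul, ← Lp_norm_sq_eq_integral]

/-- The splitting `y₁ ∂ₓp₁ - y₂ ∂ₓp₂ = y₁ ∂ₓq + (y₁ - y₂) ∂ₓp₂` is used. Young's inequality absorbs
the first term into half of the viscous term and splits the second into the source `‖y₁ - y₂‖_V²`
and the coefficient `4‖∂ₓp₂‖²`. -/
theorem adjoint_difference_ae_le (hν : 0 < ν) {y_d : H} {y₁ y₂ p₁ p₂ : W T}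
    (h₁ : IsAdjointSolution ν T y_d y₁ p₁) (h₂ : IsAdjointSolution ν T y_d y₂ p₂) :
    ∀ᵐ t ∂(timeMeasure T), ν * ‖V.dx ((p₁ - p₂).toL2V t)‖ ^ 2
      - (4 / ν * ‖y₁.toL2V t‖ ^ 2 + 4 * ‖V.dx (p₂.toL2V t)‖ ^ 2)
        * ‖V.val ((p₁ - p₂).toL2V t)‖ ^ 2 - ‖(y₁ - y₂).toL2V t‖ ^ 2
      ≤ 2 * (p₁ - p₂).dt t ((p₁ - p₂).toL2V t) := by
  filter_upwards [h₁.ae_forall, h₂.ae_forall, Lp.coeFn_sub p₁.toL2V p₂.toL2V,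
    Lp.coeFn_sub y₁.toL2V y₂.toL2V, Lp.coeFn_sub p₁.dt p₂.dt] with t e₁ e₂ hp hy hd
  have hp' : (p₁ - p₂).toL2V t = p₁.toL2V t - p₂.toL2V t := hp
  have hy' : (y₁ - y₂).toL2V t = y₁.toL2V t - y₂.toL2V t := hy
  have hd' : (p₁ - p₂).dt t = p₁.dt t - p₂.dt t := hd
  rw [hy', hd', hp']
  set q := p₁.toL2V t - p₂.toL2V t with hq
  have f₁ := e₁ q
  have f₂ := e₂ q
  have c₁ := integral_convection_sub_middle (y₁.toL2V t) (V.dx (p₁.toL2V t)) (V.dx (p₂.toL2V t))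
    (V.val q)
  have c₂ := integral_convection_sub_left (y₁.toL2V t) (y₂.toL2V t) (V.dx (p₂.toL2V t)) (V.val q)
  rw [← map_sub, ← hq] at c₁
  have b₁ := le_abs_self (∫ x, V.val (y₁.toL2V t) x * V.dx q x * V.val q x)
  have b₂ := le_abs_self (∫ x, V.val (y₁.toL2V t - y₂.toL2V t) x * V.dx (p₂.toL2V t) x * V.val q x)
  have b₃ := abs_integral_convection_le (y₁.toL2V t) (V.dx q) (V.val q)
  have b₄ := abs_integral_convection_le (y₁.toL2V t - y₂.toL2V t) (V.dx (p₂.toL2V t)) (V.val q)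
  have b₅ := convection_young hν ‖y₁.toL2V t‖ ‖V.dx q‖ ‖V.val q‖
  have b₆ := sq_nonneg (‖y₁.toL2V t - y₂.toL2V t‖ - 2 * (‖V.dx (p₂.toL2V t)‖ * ‖V.val q‖))
  have hinner : inner ℝ (V.dx (p₁.toL2V t)) (V.dx q) - inner ℝ (V.dx (p₂.toL2V t)) (V.dx q)
      = ‖V.dx q‖ ^ 2 := by
    rw [← inner_sub_left, ← map_sub, ← hq, real_inner_self_eq_norm_sq]
  have hν' : ν * inner ℝ (V.dx (p₁.toL2V t)) (V.dx q) - ν * inner ℝ (V.dx (p₂.toL2V t)) (V.dx q)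
      = ν * ‖V.dx q‖ ^ 2 := by rw [← mul_sub, hinner]
  rw [sub_apply]
  linarith

theorem adjoint_difference_norm_sq_le (hν : 0 < ν) (hT : 0 < T) {y_d : H} {y₁ y₂ p₁ p₂ : W T}
    (h₁ : IsAdjointSolution ν T y_d y₁ p₁) (h₂ : IsAdjointSolution ν T y_d y₂ p₂) {n : ℕ}
    (hn : 4 / ν * ‖y₁.toL2V‖ ^ 2 + 4 * ∫ t in Ioo 0 T, ‖V.dx (p₂.toL2V t)‖ ^ 2 ≤ n / 2) :
    ‖p₁.toL2V - p₂.toL2V‖ ^ 2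
      ≤ (T + 1 / ν) * (2 ^ n * (1 / T + 2)) * ‖y₁ - y₂‖ ^ 2 := by
  have i₁ : IntegrableOn (fun t => 4 / ν * ‖y₁.toL2V t‖ ^ 2) (Ioo 0 T) :=
    (integrable_norm_sq_Lp_time _).const_mul _
  have i₂ : IntegrableOn (fun t => 4 * ‖V.dx (p₂.toL2V t)‖ ^ 2) (Ioo 0 T) :=
    (integrable_norm_dx_sq _).const_mul _
  obtain ⟨r₁, r₂⟩ := energy_estimate hT (p := p₁ - p₂) hν
    (a := fun t => 4 / ν * ‖y₁.toL2V t‖ ^ 2 + 4 * ‖V.dx (p₂.toL2V t)‖ ^ 2)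
    (b := fun t => ‖(y₁ - y₂).toL2V t‖ ^ 2)
    (i₁.add i₂)
    (fun t => by positivity) (integrable_norm_sq_Lp_time _) (fun t => by positivity)
    (adjoint_difference_ae_le hν h₁ h₂) (n := n) (by
      rw [integral_add i₁ i₂, integral_const_mul, integral_const_mul,
        ← Lp_norm_sq_eq_integral]
      exact hn)
  have hval : ‖(p₁ - p₂).valueAt T‖ = ‖(y₁ - y₂).valueAt T‖ := by
    rw [valueAt_sub hT _ _ (right_mem_Icc.2 hT.le), valueAt_sub hT _ _ (right_mem_Icc.2 hT.le),
      h₁.valueAt_eq, h₂.valueAt_eq, sub_sub_sub_cancel_left, norm_sub_rev]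
  rw [hval, ← Lp_norm_sq_eq_integral] at r₁ r₂
  set K := ‖(y₁ - y₂).valueAt T‖ ^ 2 + ‖(y₁ - y₂).toL2V‖ ^ 2 with hK
  have hK' : K ≤ (1 / T + 2) * ‖y₁ - y₂‖ ^ 2 := by
    have k1 := norm_valueAt_sq_le hT (y₁ - y₂)
    have k2 := (y₁ - y₂).norm_sq_eq
    linarith [sq_nonneg ‖(y₁ - y₂).dt‖]
  have i1 : ∫ t in Ioo 0 T, ‖V.val ((p₁ - p₂).toL2V t)‖ ^ 2 ≤ T * (2 ^ n * K) := by
    refine (integral_mono_ae (integrable_norm_val_sq _) (integrable_const (2 ^ n * K)) r₁).trans ?_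
    simp [hT.le]
  have i2 : ∫ t in Ioo 0 T, ‖V.dx ((p₁ - p₂).toL2V t)‖ ^ 2 ≤ 1 / ν * (2 ^ n * K) := by
    rw [one_div, le_inv_mul_iff₀ hν]
    exact r₂
  have e := norm_L2V_sq_eq (p₁ - p₂).toL2V
  change ‖p₁.toL2V - p₂.toL2V‖ ^ 2 = _ at e
  rw [e]
  calc _ ≤ T * (2 ^ n * K) + 1 / ν * (2 ^ n * K) := add_le_add i1 i2
    _ = (T + 1 / ν) * 2 ^ n * K := by ring
    _ ≤ (T + 1 / ν) * 2 ^ n * ((1 / T + 2) * ‖y₁ - y₂‖ ^ 2) := by gcongr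
    _ = _ := by ring

/-- The adjoint solution map is Lipschitz on bounded sets. -/
theorem exists_lipschitz_const_adjoint (hν : 0 < ν) (hT : 0 < T) (y_d : H) (M : ℝ) :
    ∃ C : ℝ, ∀ y₁ y₂ p₁ p₂ : W T,
      (y₁.normLinftyV ≤ ENNReal.ofReal M ∨ ‖y₁‖ ≤ M) →
      (y₂.normLinftyV ≤ ENNReal.ofReal M ∨ ‖y₂‖ ≤ M) →
      IsAdjointSolution ν T y_d y₁ p₁ → IsAdjointSolution ν T y_d y₂ p₂ →
      ‖p₁.toL2V - p₂.toL2V‖ ≤ C * ‖y₁ - y₂‖ := by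
  -- `n` counts the Gronwall doublings for `p₂` alone and yields the bound `R / ν` for `∂ₓp₂`; `m`
  -- counts those for the difference, whose coefficient involves that bound.
  obtain ⟨n, hn⟩ := exists_nat_ge (2 * (4 / ν * ((T + 1) * M ^ 2)))
  set R := 2 ^ n * (2 * ‖y_d‖ ^ 2 + 2 * ((1 / T + 1) * M ^ 2)) with hR
  obtain ⟨m, hm⟩ := exists_nat_ge (2 * (4 / ν * ((T + 1) * M ^ 2) + 4 * (1 / ν * R)))
  refine ⟨√((T + 1 / ν) * (2 ^ m * (1 / T + 2))), fun y₁ y₂ p₁ p₂ b₁ b₂ h₁ h₂ => ?_⟩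
  have hy : ∀ y : W T, (y.normLinftyV ≤ ENNReal.ofReal M ∨ ‖y‖ ≤ M) →
      4 / ν * ‖y.toL2V‖ ^ 2 ≤ 4 / ν * ((T + 1) * M ^ 2) := fun y b =>
    mul_le_mul_of_nonneg_left (norm_toL2V_sq_le hT b) (by positivity)
  have hp₂ : ∫ t in Ioo 0 T, ‖V.dx (p₂.toL2V t)‖ ^ 2 ≤ 1 / ν * R := by
    rw [one_div, le_inv_mul_iff₀ hν]
    refine (h₂.integral_norm_dx_sq_le hν hT (n := n) (by linarith [hy y₂ b₂])).trans ?_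
    rw [hR]
    gcongr
    have h1 := norm_valueAt_sq_le_of_bounded hT b₂
    have h2 : ‖y_d - y₂.valueAt T‖ ^ 2 ≤ (‖y_d‖ + ‖y₂.valueAt T‖) ^ 2 := by
      gcongr
      exact norm_sub_le _ _
    linarith [sq_nonneg (‖y_d‖ - ‖y₂.valueAt T‖)]
  have hmain := adjoint_difference_norm_sq_le hν hT h₁ h₂ (n := m) (by linarith [hy y₁ b₁])
  refine le_of_sq_le_sq ?_ (by positivity)
  rw [mul_pow, Real.sq_sqrt (by positivity)]
  exact hmain

end Adjoint

end BurgersAdjoint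

end

theorem mainTheorem9 (ν T : ℝ) (hν : 0 < ν) (hT : 0 < T) (y_d : BurgersAdjoint.H) (M : ℝ) :
    ∃ C : ℝ, ∀ y₁ y₂ p₁ p₂ : BurgersAdjoint.W T,
      (y₁.normLinftyV ≤ ENNReal.ofReal M ∨ ‖y₁‖ ≤ M) →
      (y₂.normLinftyV ≤ ENNReal.ofReal M ∨ ‖y₂‖ ≤ M) →
      BurgersAdjoint.IsAdjointSolution ν T y_d y₁ p₁ →
      BurgersAdjoint.IsAdjointSolution ν T y_d y₂ p₂ →
      ‖p₁.toL2V - p₂.toL2V‖ ≤ C * ‖y₁ - y₂‖ :=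
  BurgersAdjoint.exists_lipschitz_const_adjoint hν hT y_d M
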